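/- Let $k$ be a field of characteristic different from $2$ and $3$ containing a primitive third root of unity $\omega$. Let $$E(6)=\{(x:y:z)\in\mathbb{P}^2_k \mid y^2z=x^3-z^3\}$$ be the equianharmonic elliptic curve, with its automorphism $g_6(x:y:z)=(\omega x:-y:z)$ of order $6$. Let $g_6$ act diagonally on $E(6)^4=E(6)\times_k E(6)\times_k E(6)\times_k E(6)$, and let $Y_{4,6}=E(6)^4/\langle g_6\rangle$ be the quotient. Then every resolution of singularities $X\to Y_{4,6}$ (that is, a proper morphism with $X$ smooth over $k$ which is an isomorphism over a dense open subset of $Y_{4,6}$ whose preimage is dense in $X$) is unirational over $k$: there is a dominant rational map $\mathbb{P}^4_k\dashrightarrow X$ over $k$. In particular the Ueno-type fourfold $X_{4,6}$, the minimal resolution of $Y_{4,6}$, obtained by blowing up the singular points of $Y_{4,6}$, is unirational over $k$. -/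

import Mathlib

open CategoryTheory CategoryTheory.Limits AlgebraicGeometry MvPolynomial

universe u

noncomputable section

namespace Ueno

/-! ### Quotients of graded algebras by homogeneous ideals -/

section GradedQuotient

variable {k A : Type u} [CommRing k] [CommRing A] [Algebra k A]

/-- The grading induced on `A ⧸ I`: the degree `n` part is the image of the degree `n` part of
`A`. -/
def quotientGrading (𝒜 : ℕ → Submodule k A) (I : Ideal A) (n : ℕ) : Submodule k (A ⧸ I) :=
  (𝒜 n).map (Ideal.Quotient.mkₐ k I).toLinearMap

variable (𝒜 : ℕ → Submodule k A) [GradedAlgebra 𝒜] (I : Ideal A)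

instance quotientGrading.gradedMonoid : SetLike.GradedMonoid (quotientGrading 𝒜 I) where
  one_mem := ⟨1, SetLike.GradedOne.one_mem, map_one (Ideal.Quotient.mkₐ k I)⟩
  mul_mem := by
    rintro i j _ _ ⟨a, ha, rfl⟩ ⟨b, hb, rfl⟩
    exact ⟨a * b, SetLike.GradedMul.mul_mem ha hb, map_mul (Ideal.Quotient.mkₐ k I) a b⟩

/-- The projection from the `i`-th graded piece of `A` to that of `A ⧸ I`. -/
def quotientGrading.proj (i : ℕ) : 𝒜 i →ₗ[k] quotientGrading 𝒜 I i :=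
  ((Ideal.Quotient.mkₐ k I).toLinearMap.restrict
    (fun _ hx => Submodule.mem_map_of_mem hx))

/-- The linear map `A → ⨁ (A ⧸ I)ᵢ`, sending an element to the classes of its components. -/
def quotientGrading.decomposeAux : A →ₗ[k] DirectSum ℕ (fun i => quotientGrading 𝒜 I i) :=
  (DirectSum.lmap (quotientGrading.proj 𝒜 I)) ∘ₗ (DirectSum.decomposeLinearEquiv 𝒜).toLinearMap

lemma quotientGrading.decomposeAux_of_mem {i : ℕ} (a : A) (ha : a ∈ 𝒜 i) :
    quotientGrading.decomposeAux 𝒜 I a =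
      DirectSum.of (fun i => quotientGrading 𝒜 I i) i (quotientGrading.proj 𝒜 I i ⟨a, ha⟩) := by
  lift a to 𝒜 i using ha
  simp only [decomposeAux, LinearMap.comp_apply, LinearEquiv.coe_coe,
    DirectSum.decomposeLinearEquiv_apply, DirectSum.decompose_coe]
  exact DirectSum.lmap_lof _ _ _

lemma quotientGrading.decomposeAux_eq_zero (hI : I.IsHomogeneous 𝒜) (a : A) (ha : a ∈ I) :
    quotientGrading.decomposeAux 𝒜 I a = 0 := by
  ext i
  have h := hI i ha
  simp only [decomposeAux, LinearMap.comp_apply, LinearEquiv.coe_coe,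
    DirectSum.decomposeLinearEquiv_apply, DirectSum.lmap_apply]
  exact Ideal.Quotient.eq_zero_iff_mem.mpr h

/-- The decomposition of an element of `A ⧸ I` into homogeneous components, computed on a
representative. -/
def quotientGrading.decompose (x : A ⧸ I) : DirectSum ℕ (fun i => quotientGrading 𝒜 I i) :=
  quotientGrading.decomposeAux 𝒜 I (Ideal.Quotient.mk_surjective x).choose

lemma quotientGrading.decompose_mk (hI : I.IsHomogeneous 𝒜) (a : A) :
    quotientGrading.decompose 𝒜 I (Ideal.Quotient.mk I a) =
      quotientGrading.decomposeAux 𝒜 I a := by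
  have h := (Ideal.Quotient.mk_surjective (Ideal.Quotient.mk I a)).choose_spec
  rw [Ideal.Quotient.mk_eq_mk_iff_sub_mem] at h
  have h0 := quotientGrading.decomposeAux_eq_zero 𝒜 I hI _ h
  unfold quotientGrading.decompose
  conv_lhs => rw [← sub_add_cancel (Ideal.Quotient.mk_surjective (Ideal.Quotient.mk I a)).choose a]
  rw [map_add, h0, zero_add]

/-- The quotient of a graded algebra by a homogeneous ideal is graded. -/
abbrev quotientGradedAlgebra (hI : I.IsHomogeneous 𝒜) : GradedAlgebra (quotientGrading 𝒜 I) where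
  __ := quotientGrading.gradedMonoid 𝒜 I
  decompose' := quotientGrading.decompose 𝒜 I
  left_inv x := by
    obtain ⟨a, rfl⟩ := Ideal.Quotient.mk_surjective x
    rw [quotientGrading.decompose_mk 𝒜 I hI]
    induction a using DirectSum.Decomposition.inductionOn 𝒜 with
    | zero => simp
    | homogeneous a =>
      rw [quotientGrading.decomposeAux_of_mem 𝒜 I a.1 a.2]
      exact DirectSum.coeAddMonoidHom_of _ _ _
    | add a b ha hb => simp only [map_add, ha, hb]
  right_inv x := by
    induction x using DirectSum.induction_on with
    | zero =>
      rw [map_zero, ← map_zero (Ideal.Quotient.mk I), quotientGrading.decompose_mk 𝒜 I hI,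
        map_zero]
    | of i x =>
      obtain ⟨_, a, ha, rfl⟩ := x
      rw [DirectSum.coeAddMonoidHom_of]
      exact (quotientGrading.decompose_mk 𝒜 I hI a).trans
        (quotientGrading.decomposeAux_of_mem 𝒜 I a ha)
    | add x y hx hy =>
      obtain ⟨a, ha⟩ := Ideal.Quotient.mk_surjective
        (DirectSum.coeAddMonoidHom (quotientGrading 𝒜 I) x)
      obtain ⟨b, hb⟩ := Ideal.Quotient.mk_surjective
        (DirectSum.coeAddMonoidHom (quotientGrading 𝒜 I) y)
      rw [← ha, quotientGrading.decompose_mk 𝒜 I hI] at hx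
      rw [← hb, quotientGrading.decompose_mk 𝒜 I hI] at hy
      rw [map_add, ← ha, ← hb, ← map_add, quotientGrading.decompose_mk 𝒜 I hI, map_add, hx, hy]

end GradedQuotient

/-! ### `Proj` as a scheme over the base field -/

section ProjOver

variable {k A : Type u} [CommRing k] [CommRing A] [Algebra k A]
  (𝒜 : ℕ → Submodule k A) [GradedAlgebra 𝒜]

/-- The structure morphism `Proj A ⟶ Spec k` of the `Proj` of a graded `k`-algebra. -/
def projStr : Proj 𝒜 ⟶ Spec (.of k) :=
  Proj.toSpecZero 𝒜 ≫ Spec.map (CommRingCat.ofHom (algebraMap k (𝒜 0)))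

/-- An automorphism of a graded `k`-algebra, given by a graded endomorphism `φ` one of whose
iterates is the identity, satisfies the condition needed to induce a morphism on `Proj`. -/
lemma irrelevant_le_map (φ : 𝒜 →+*ᵍ 𝒜) {m : ℕ} (hφ : ∀ a, φ^[m + 1] a = a) :
    HomogeneousIdeal.irrelevant 𝒜 ≤ (HomogeneousIdeal.irrelevant 𝒜).map φ := by
  rw [HomogeneousIdeal.irrelevant_le]
  intro i hi a ha
  have hmem : ∀ n : ℕ, φ^[n] a ∈ 𝒜 i := by
    intro n
    induction n with
    | zero => exact ha
    | succ n ih => rw [Function.iterate_succ_apply']; exact φ.map_mem ih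
  have h := hφ a
  rw [Function.iterate_succ_apply'] at h
  change a ∈ Ideal.map φ _
  rw [← h]
  exact Ideal.mem_map_of_mem _ (HomogeneousIdeal.mem_irrelevant_of_mem _ hi (hmem m))

lemma awayι_projMap_str (φ : 𝒜 →+*ᵍ 𝒜) (hφ : HomogeneousIdeal.irrelevant 𝒜 ≤
    (HomogeneousIdeal.irrelevant 𝒜).map φ)
    (hk : ∀ c : k, φ (algebraMap k A c) = algebraMap k A c)
    {i : ℕ} (hi : 0 < i) (a : A) (ha : a ∈ 𝒜 i) :
    Proj.awayι 𝒜 (φ a) (φ.2 ha) hi ≫ Proj.map φ hφ ≫ projStr 𝒜 =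
      Proj.awayι 𝒜 (φ a) (φ.2 ha) hi ≫ projStr 𝒜 := by
  unfold projStr
  rw [Proj.awayι_comp_map_assoc φ hφ hi a ha, Proj.awayι_toSpecZero_assoc,
    Proj.awayι_toSpecZero_assoc, ← Spec.map_comp, ← Spec.map_comp, ← Spec.map_comp]
  congr 1
  refine CommRingCat.hom_ext (RingHom.ext fun c => ?_)
  change HomogeneousLocalization.Away.map φ a (HomogeneousLocalization.fromZeroRingHom 𝒜 _
    (algebraMap k (𝒜 0) c)) = HomogeneousLocalization.fromZeroRingHom 𝒜 _ (algebraMap k (𝒜 0) c)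
  have h : (⟨φ (algebraMap k (𝒜 0) c : 𝒜 0), φ.map_mem (algebraMap k (𝒜 0) c).2⟩ : 𝒜 0) =
      algebraMap k (𝒜 0) c := Subtype.ext (hk c)
  rw [HomogeneousLocalization.ext_iff_val]
  refine Eq.trans ?_ (congrArg (fun z => (HomogeneousLocalization.fromZeroRingHom 𝒜
    (Submonoid.powers (φ a)) z).val) h)
  change HomogeneousLocalization.val (HomogeneousLocalization.map φ _
    (HomogeneousLocalization.mk _)) = _
  rw [HomogeneousLocalization.map_mk]
  refine Eq.trans ?_ (HomogeneousLocalization.val_mk _).symm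
  rw [HomogeneousLocalization.val_mk]
  exact congrArg (Localization.mk _) (Subtype.ext (map_one φ))

/-- A graded `k`-algebra endomorphism induces a morphism over `k` on `Proj`. -/
lemma projMap_str (φ : 𝒜 →+*ᵍ 𝒜) (hφ : HomogeneousIdeal.irrelevant 𝒜 ≤
    (HomogeneousIdeal.irrelevant 𝒜).map φ)
    (hk : ∀ c : k, φ (algebraMap k A c) = algebraMap k A c) :
    Proj.map φ hφ ≫ projStr 𝒜 = projStr 𝒜 :=
  (Proj.mapAffineOpenCover φ hφ).openCover.hom_ext _ _ fun s =>
    awayι_projMap_str 𝒜 φ hφ hk s.1.2 s.2.1 s.2.2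

end ProjOver

section ProjectiveSpace

variable (k : Type u) [CommRing k] (n : ℕ)

attribute [local instance] MvPolynomial.gradedAlgebra

/-- Projective space `ℙⁿ` over `k`, as the `Proj` of the polynomial ring in `n + 1` variables. -/
def projectiveSpace : Scheme.{u} := Proj (homogeneousSubmodule (Fin (n + 1)) k)

/-- The structure morphism of projective space. -/
def projectiveSpaceStr : projectiveSpace k n ⟶ Spec (.of k) :=
  projStr (homogeneousSubmodule (Fin (n + 1)) k)

end ProjectiveSpace

/-! ### The equianharmonic curve `E(6)` and its automorphism of order `6` -/

section EquianharmonicCurve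

variable (k : Type u) [Field k]

attribute [local instance] MvPolynomial.gradedAlgebra

/-- The homogeneous cubic `y² z - (x³ - z³)`; the variables `0, 1, 2` are `x, y, z`. -/
def cubic : MvPolynomial (Fin 3) k := X 1 ^ 2 * X 2 - (X 0 ^ 3 - X 2 ^ 3)

lemma cubic_isHomogeneous : (cubic k).IsHomogeneous 3 := by
  unfold cubic
  refine IsHomogeneous.sub ?_ (IsHomogeneous.sub ?_ ?_)
  · exact ((isHomogeneous_X k 1).pow 2).mul (isHomogeneous_X k 2)
  · exact (isHomogeneous_X k 0).pow 3
  · exact (isHomogeneous_X k 2).pow 3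

/-- The homogeneous ideal of the plane curve `E(6)`. -/
abbrev E6Ideal : Ideal (MvPolynomial (Fin 3) k) := Ideal.span {cubic k}

lemma E6Ideal_isHomogeneous : (E6Ideal k).IsHomogeneous (homogeneousSubmodule (Fin 3) k) := by
  refine Ideal.homogeneous_span _ _ ?_
  rintro _ rfl
  exact ⟨3, (mem_homogeneousSubmodule 3 _).mpr (cubic_isHomogeneous k)⟩

/-- The homogeneous coordinate ring `k[x, y, z] / (y² z - x³ + z³)` of `E(6)`. -/
abbrev E6Ring : Type u := MvPolynomial (Fin 3) k ⧸ E6Ideal k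

/-- The grading of the homogeneous coordinate ring of `E(6)`. -/
abbrev E6Grading : ℕ → Submodule k (E6Ring k) :=
  quotientGrading (homogeneousSubmodule (Fin 3) k) (E6Ideal k)

instance E6GradedAlgebra : GradedAlgebra (E6Grading k) :=
  quotientGradedAlgebra (homogeneousSubmodule (Fin 3) k) (E6Ideal k) (E6Ideal_isHomogeneous k)

/-- The curve `E(6) = {(x : y : z) | y² z = x³ - z³} ⊆ ℙ²`. -/
def E6 : Scheme.{u} := Proj (E6Grading k)

/-- The structure morphism of `E(6)`. -/
def E6Str : E6 k ⟶ Spec (.of k) := projStr (E6Grading k)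

variable {k} {ω : k}

/-- The substitution `x ↦ ω x, y ↦ -y, z ↦ z` on `k[x, y, z]`. -/
def g6Poly (ω : k) : MvPolynomial (Fin 3) k →ₐ[k] MvPolynomial (Fin 3) k :=
  aeval ![C ω * X 0, -X 1, X 2]

lemma g6Poly_cubic (hω : IsPrimitiveRoot ω 3) : g6Poly ω (cubic k) = cubic k := by
  have h : (C ω : MvPolynomial (Fin 3) k) ^ 3 = 1 := by rw [← map_pow, hω.pow_eq_one, map_one]
  simp only [g6Poly, cubic, map_sub, map_mul, map_pow, aeval_X, Matrix.cons_val_zero,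
    Matrix.cons_val_one, Matrix.cons_val]
  linear_combination (-X 0 ^ 3) * h

lemma g6Poly_iterate (hω : IsPrimitiveRoot ω 3) (p : MvPolynomial (Fin 3) k) :
    (g6Poly ω)^[6] p = p := by
  have h : (C ω : MvPolynomial (Fin 3) k) ^ 3 = 1 := by rw [← map_pow, hω.pow_eq_one, map_one]
  have hC : g6Poly ω (C ω) = C ω := (g6Poly ω).commutes ω
  have h0 : g6Poly ω (X 0) = C ω * X 0 := by simp [g6Poly]
  have h1 : g6Poly ω (X 1) = -X 1 := by simp [g6Poly]
  have h2 : g6Poly ω (X 2) = X 2 := by simp [g6Poly]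
  have key : (g6Poly ω) ^ 6 = AlgHom.id k _ := by
    refine MvPolynomial.algHom_ext fun i => ?_
    fin_cases i
    · simp only [pow_succ, pow_zero, one_mul, AlgHom.mul_apply, Fin.zero_eta, h0, map_mul, hC,
        AlgHom.id_apply]
      linear_combination ((C ω) ^ 3 + 1) * X 0 * h
    · simp [pow_succ, AlgHom.mul_apply, h1]
    · simp [pow_succ, AlgHom.mul_apply, h2]
  have := DFunLike.congr_fun key p
  simpa [pow_succ, AlgHom.mul_apply] using this

lemma g6Poly_mem (ω : k) {n : ℕ} {p : MvPolynomial (Fin 3) k}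
    (hp : p ∈ homogeneousSubmodule (Fin 3) k n) :
    g6Poly ω p ∈ homogeneousSubmodule (Fin 3) k n := by
  rw [mem_homogeneousSubmodule] at hp ⊢
  have h := hp.aeval (![C ω * X 0, -X 1, X 2] : Fin 3 → MvPolynomial (Fin 3) k) (n := 1)
    (fun i => by
      fin_cases i
      · simpa using (isHomogeneous_C (Fin 3) ω).mul (isHomogeneous_X k (0 : Fin 3))
      · exact (isHomogeneous_X k (1 : Fin 3)).neg
      · exact isHomogeneous_X k (2 : Fin 3))
  simpa [g6Poly] using h

/-- The graded `k`-algebra automorphism of the homogeneous coordinate ring of `E(6)` given by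
`x ↦ ω x, y ↦ -y, z ↦ z`. -/
def g6Ring (hω : IsPrimitiveRoot ω 3) : E6Grading k →+*ᵍ E6Grading k where
  toRingHom := Ideal.quotientMap (E6Ideal k) (g6Poly ω).toRingHom (by
    rw [Ideal.span_le]
    rintro _ rfl
    change g6Poly ω (cubic k) ∈ E6Ideal k
    rw [g6Poly_cubic hω]
    exact Ideal.subset_span rfl)
  map_mem := by
    rintro i _ ⟨a, ha, rfl⟩
    exact ⟨g6Poly ω a, g6Poly_mem ω ha, rfl⟩

lemma g6Ring_iterate (hω : IsPrimitiveRoot ω 3) (a : E6Ring k) : (g6Ring hω)^[5 + 1] a = a := by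
  obtain ⟨p, rfl⟩ := Ideal.Quotient.mk_surjective a
  have h : Function.Semiconj (Ideal.Quotient.mk (E6Ideal k)) (g6Poly ω) (g6Ring hω) :=
    fun _ => rfl
  rw [← (h.iterate_right (5 + 1)).eq p, g6Poly_iterate hω]

/-- The automorphism `g₆ : (x : y : z) ↦ (ω x : -y : z)` of `E(6)`. -/
def g6 (hω : IsPrimitiveRoot ω 3) : E6 k ⟶ E6 k :=
  Proj.map (g6Ring hω) (irrelevant_le_map (E6Grading k) (g6Ring hω) (g6Ring_iterate hω))

lemma g6_str (hω : IsPrimitiveRoot ω 3) : g6 hω ≫ E6Str k = E6Str k :=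
  projMap_str (E6Grading k) (g6Ring hω) _ fun c =>
    congrArg (Ideal.Quotient.mk (E6Ideal k)) ((g6Poly ω).commutes c)

end EquianharmonicCurve

/-! ### The fourfold `E(6)⁴` with the diagonal action -/

section Product

/-- The diagonal endomorphism `g × g` of `C ×ₖ C`. -/
def diagonalSq {S C : Scheme.{u}} (s : C ⟶ S) (g : C ⟶ C) (hg : g ≫ s = s) :
    pullback s s ⟶ pullback s s :=
  pullback.map s s s s g g (𝟙 S) (by simp [hg]) (by simp [hg])

lemma diagonalSq_str {S C : Scheme.{u}} (s : C ⟶ S) (g : C ⟶ C) (hg : g ≫ s = s) :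
    diagonalSq s g hg ≫ (pullback.fst s s ≫ s) = pullback.fst s s ≫ s := by
  rw [diagonalSq, pullback.map, pullback.lift_fst_assoc, Category.assoc, hg]

variable (k : Type u) [Field k]

/-- The structure morphism of `E(6) ×ₖ E(6)`. -/
def E6SqStr : pullback (E6Str k) (E6Str k) ⟶ Spec (.of k) := pullback.fst _ _ ≫ E6Str k

/-- `Z₄(6) = E(6)⁴`, as `(E(6) ×ₖ E(6)) ×ₖ (E(6) ×ₖ E(6))`. -/
def Z46 : Scheme.{u} := pullback (E6SqStr k) (E6SqStr k)

/-- The structure morphism of `E(6)⁴`. -/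
def Z46Str : Z46 k ⟶ Spec (.of k) := pullback.fst _ _ ≫ E6SqStr k

variable {k} {ω : k}

/-- The diagonal automorphism `(g₆, g₆, g₆, g₆)` of `E(6)⁴`. -/
def g46 (hω : IsPrimitiveRoot ω 3) : Z46 k ⟶ Z46 k :=
  diagonalSq (E6SqStr k) (diagonalSq (E6Str k) (g6 hω) (g6_str hω)) (diagonalSq_str _ _ _)

end Product

/-! ### Quotients, resolutions and unirationality -/

/-- `π : Z ⟶ Y` is the quotient of the scheme `Z` by the finite cyclic group generated by the
automorphism `g`: it is invariant, `Y` carries the quotient topology, the fibres of `π` are the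
orbits of `g`, and the functions on an open `U ⊆ Y` are the `g`-invariant functions on `π⁻¹ U`. -/
structure IsCyclicQuotient {Z Y : Scheme.{u}} (g : Z ⟶ Z) (π : Z ⟶ Y) : Prop where
  invariant : g ≫ π = π
  isQuotientMap : Topology.IsQuotientMap π
  fiber_eq_orbit (z w : Z) : π z = π w ↔ ∃ n : ℕ, g^[n] z = w
  app_injective (U : Y.Opens) : Function.Injective (π.app U)
  exists_app_eq (U : Y.Opens) (hU : π ⁻¹ᵁ U ≤ g ⁻¹ᵁ π ⁻¹ᵁ U) (s : Γ(Z, π ⁻¹ᵁ U))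
    (hs : g.appLE (π ⁻¹ᵁ U) (π ⁻¹ᵁ U) hU s = s) : ∃ t : Γ(Y, U), π.app U t = s

/-- `f : X ⟶ Y` is a resolution of singularities of the `S`-scheme `Y`: `X` is smooth over `S`, and
`f` is proper and an isomorphism over a dense open subset of `Y` with dense preimage in `X`. -/
structure IsResolution {S X Y : Scheme.{u}} (sY : Y ⟶ S) (f : X ⟶ Y) : Prop where
  smooth : Smooth (f ≫ sY)
  proper : IsProper f
  birational : ∃ V : Y.Opens, Dense (V : Set Y) ∧ Dense ((f ⁻¹ᵁ V : X.Opens) : Set X) ∧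
    IsIso (f ∣_ V)

/-- The `k`-scheme `X` is `n`-unirational: there is a dominant rational map `ℙⁿ ⤏ X` over `k`. -/
def IsUnirational (n : ℕ) {k : Type u} [CommRing k] {X : Scheme.{u}} (sX : X ⟶ Spec (.of k)) :
    Prop :=
  ∃ φ : projectiveSpace k n ⤏ X, φ.IsDominant ∧
    φ.compHom sX = (projectiveSpaceStr k n).toRationalMap

end Ueno

end

/-!
Write `Y = E(6)⁴ / ⟨g₆⟩` and let `F` be the field of rational functions in four variables over `k`.
It suffices to construct a `k`-morphism `Spec F ⟶ Y` with dense image: its image lies in every dense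
open subset, so it lifts to any resolution `X`, and since `X` is of finite type it spreads out to a
dominant morphism from an open subset of an affine chart of `ℙ⁴`
(`isUnirational_of_isDominant`).

A point of `Y` over `F` is given by four points, over `F`, on a common sextic twist
`κ y² = κ x³ - 1` of the affine curve `y² = x³ - 1`. Over the ring `R = F[θ] / (θ⁶ - κ)` the twist
becomes trivial, by `(x, y) ↦ (θ² x, θ³ y)`, and the automorphism `θ ↦ -ω² θ` of `R` acts on the
resulting points in the same way as `g₆`. Hence `Spec R ⟶ E(6)⁴ ⟶ Y` is invariant and descends to
`Spec F` (`exists_desc_of_isInvariant`). The image of `Spec F` is dense as soon as the elements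
`θ² xᵢ` are algebraically independent over `k`, because the functions on the fourfold product of the
affine curve then embed into an algebraic closure of `F` (`injective_of_adjoin_points`).

Four points on a twist arise from interpolation. Let `d₀, …, d₃` be nodes and let `f` be a quadratic
polynomial whose values at the nodes are cubes, `f (dᵢ) = xᵢ³` up to a common factor. Completing the
square in `f` gives `(2 a dᵢ + b)² = 4 a xᵢ³ - disc`, so `(xᵢ, 2 a dᵢ + b)` are four points on one
sextic twist. Such an `f` exists if and only if `x` lies on the diagonal cubic surface
`∑ wᵢ xᵢ³ = 0`, where `wᵢ` are the Vandermonde weights of the nodes. This surface contains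
`(1, 1, 1, 1)`, but its tangent plane there cuts out a singular cubic curve; this curve has the
rational point `basePt d`, and residual intersections of the surface with the tangent lines at
`basePt d` give a one-parameter family of points `surfPt d g`. Normalising `d₁ - d₀ = 1` leaves
three parameters for the nodes, so that there are four parameters altogether.

The parameters can be recovered, up to algebraic extensions, from the points (`params_mem`), which
yields the algebraic independence (`exists_twist_points`) by comparing transcendence degrees. The
required nonvanishing of some polynomials in the parameters holds in all characteristics other than
`2` and `3` because their values at suitable integral points have greatest common divisors of the
form `2 ^ a * 3 ^ b`.
-/

namespace Ueno

/-! ### A family of points on diagonal cubic surfaces -/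

section CubicSurface

variable {A B : Type*} [CommRing A] [CommRing B]

/-- The product of the differences `dᵢ - dⱼ`, `i < j`, of four ring elements. -/
def vand (d : Fin 4 → A) : A :=
  (d 0 - d 1) * (d 0 - d 2) * (d 0 - d 3) * (d 1 - d 2) * (d 1 - d 3) * (d 2 - d 3)

/-- The weight `vand d / ∏ (dᵢ - dⱼ)`, the product being over `j ≠ i`, as a polynomial in `d`. A
vector `v` is the vector of values at `d` of a polynomial of degree at most `2` if and only if
`∑ wt d i * v i = 0`. -/
def wt (d : Fin 4 → A) : Fin 4 → A :=
  ![(d 1 - d 2) * (d 1 - d 3) * (d 2 - d 3), -((d 0 - d 2) * (d 0 - d 3) * (d 2 - d 3)),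
    (d 0 - d 1) * (d 0 - d 3) * (d 1 - d 3), -((d 0 - d 1) * (d 0 - d 2) * (d 1 - d 2))]

/-- The complete homogeneous symmetric polynomial of degree `3` in four variables. -/
def hsymm3 (d : Fin 4 → A) : A :=
  d 0 ^ 3 + d 0 ^ 2 * (d 1 + d 2 + d 3) + d 0 * (d 1 ^ 2 + d 2 ^ 2 + d 3 ^ 2 + d 1 * d 2 +
    d 1 * d 3 + d 2 * d 3) + d 1 ^ 3 + d 1 ^ 2 * (d 2 + d 3) + d 1 * (d 2 ^ 2 + d 3 ^ 2 + d 2 * d 3)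
    + d 2 ^ 3 + d 2 ^ 2 * d 3 + d 2 * d 3 ^ 2 + d 3 ^ 3

/-- A point of the cubic surface `∑ wt d i * xᵢ³ = 0`. For varying `d` with fixed differences, these
points run through the curve cut out by the tangent plane at `(1, 1, 1, 1)`. -/
def basePt (d : Fin 4 → A) (i : Fin 4) : A :=
  hsymm3 d - 3 * (d 0 + d 1 + d 2 + d 3) * d i ^ 2

/-- The coefficients of the cubic form `∑ wt d i * xᵢ³` in the coordinates in which `basePt d` is
`(1, 1, 1, 1)`. -/
def mass (d : Fin 4 → A) (i : Fin 4) : A := wt d i * basePt d i ^ 3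

/-- For `∑ mᵢ = 0`, the residual intersection of the surface `∑ mᵢ Xᵢ³ = 0` with its tangent line at
`(1, 1, 1, 1)` in the direction `(g m₁, -g m₀, m₃, -m₂)`. -/
def residual (m : Fin 4 → A) (g : A) (i : Fin 4) : A :=
  (g ^ 3 * m 0 * m 1 * (m 1 - m 0) - m 2 * m 3 * (m 3 - m 2)) -
    3 * (g ^ 2 * m 0 * m 1 - m 2 * m 3) * (![g * m 1, -(g * m 0), m 3, -m 2] : Fin 4 → A) i

/-- The point of the cubic surface `∑ wt d i * xᵢ³ = 0` with parameters `d` and `g`. -/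
def surfPt (d : Fin 4 → A) (g : A) (i : Fin 4) : A := basePt d i * residual (mass d) g i

/-- `vand d` times the leading coefficient of the quadratic polynomial with values `vᵢ` at `dᵢ`. -/
def quad2 (d v : Fin 4 → A) : A := ∑ i, wt d i * d i * v i

/-- `vand d` times the linear coefficient of the quadratic polynomial with values `vᵢ` at `dᵢ`. -/
def quad1 (d v : Fin 4 → A) : A :=
  ∑ i, wt d i * d i ^ 2 * v i - (d 0 + d 1 + d 2 + d 3) * quad2 d v

/-- `vand d` times the constant coefficient of the quadratic polynomial with values `vᵢ` at `dᵢ`. -/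
def quad0 (d v : Fin 4 → A) : A := vand d * v 0 - quad1 d v * d 0 - quad2 d v * d 0 ^ 2

/-- `-(vand d) ^ 2` times the discriminant of the quadratic polynomial with values `vᵢ` at `dᵢ`. -/
def quadDisc (d v : Fin 4 → A) : A := 4 * quad0 d v * quad2 d v - quad1 d v ^ 2

lemma sum_wt (d : Fin 4 → A) : ∑ i, wt d i = 0 := by
  simp [Fin.sum_univ_four, wt]; ring

lemma sum_wt_mul_sq (d : Fin 4 → A) : ∑ i, wt d i * d i ^ 2 = 0 := by
  simp [Fin.sum_univ_four, wt]; ring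

lemma sum_wt_mul_pow_four (d : Fin 4 → A) :
    ∑ i, wt d i * d i ^ 4 = vand d * (d 0 + d 1 + d 2 + d 3) := by
  simp [Fin.sum_univ_four, wt, vand]; ring

lemma sum_wt_mul_pow_six (d : Fin 4 → A) : ∑ i, wt d i * d i ^ 6 = vand d * hsymm3 d := by
  simp [Fin.sum_univ_four, wt, vand, hsymm3]; ring

lemma sum_wt_mul_basePt (d : Fin 4 → A) : ∑ i, wt d i * basePt d i = 0 := by
  have h0 := sum_wt d
  have h2 := sum_wt_mul_sq d
  simp only [Fin.sum_univ_four, basePt] at *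
  linear_combination hsymm3 d * h0 - 3 * (d 0 + d 1 + d 2 + d 3) * h2

lemma sum_mass (d : Fin 4 → A) : ∑ i, mass d i = 0 := by
  have h0 := sum_wt d
  have h2 := sum_wt_mul_sq d
  have h4 := sum_wt_mul_pow_four d
  have h6 := sum_wt_mul_pow_six d
  simp only [Fin.sum_univ_four, mass, basePt] at *
  generalize hsymm3 d = T at *
  generalize vand d = V at *
  generalize wt d = w at *
  generalize hs : d 0 + d 1 + d 2 + d 3 = s at *
  linear_combination T ^ 3 * h0 - 9 * T ^ 2 * s * h2 + 27 * T * s ^ 2 * h4 - 27 * s ^ 3 * h6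

lemma sum_mul_residual {m : Fin 4 → A} (hm : ∑ i, m i = 0) (g : A) :
    ∑ i, m i * residual m g i = 0 := by
  simp only [Fin.sum_univ_four, residual, Matrix.cons_val] at *
  linear_combination (g ^ 3 * m 0 * m 1 * (m 1 - m 0) - m 2 * m 3 * (m 3 - m 2)) * hm

lemma sum_mul_residual_pow_three {m : Fin 4 → A} (hm : ∑ i, m i = 0) (g : A) :
    ∑ i, m i * residual m g i ^ 3 = 0 := by
  simp only [Fin.sum_univ_four, residual, Matrix.cons_val] at *
  obtain h : m 3 = -(m 0 + m 1 + m 2) := by linear_combination hm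
  rw [h]; ring

lemma sum_wt_mul_surfPt_pow_three (d : Fin 4 → A) (g : A) :
    ∑ i, wt d i * surfPt d g i ^ 3 = 0 := by
  rw [← sum_mul_residual_pow_three (sum_mass d) g]
  exact Finset.sum_congr rfl fun i _ => by simp only [surfPt, mass]; ring

/-- The surface point lies on the tangent plane at the base point. -/
lemma sum_wt_mul_basePt_sq_mul_surfPt (d : Fin 4 → A) (g : A) :
    ∑ i, wt d i * basePt d i ^ 2 * surfPt d g i = 0 := by
  rw [← sum_mul_residual (sum_mass d) g]
  exact Finset.sum_congr rfl fun i _ => by simp only [surfPt, mass]; ring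

lemma vand_mul_eq_quad (d v : Fin 4 → A) (h : ∑ i, wt d i * v i = 0) (i : Fin 4) :
    vand d * v i = quad0 d v + quad1 d v * d i + quad2 d v * d i ^ 2 := by
  simp only [quad0, quad1, quad2, vand, Fin.sum_univ_four, wt, Matrix.cons_val] at *
  fin_cases i <;> simp only [Fin.zero_eta, Fin.mk_one, Fin.reduceFinMk]
  · ring
  · linear_combination (d 1 - d 0) * d 2 * d 3 * h
  · linear_combination (d 2 - d 0) * d 1 * d 3 * h
  · linear_combination (d 3 - d 0) * d 1 * d 2 * h

/-- Completing the square in the quadratic polynomial through the points `(dᵢ, vᵢ)`. -/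
lemma quad_complete_square (d v : Fin 4 → A) (h : ∑ i, wt d i * v i = 0) (i : Fin 4) :
    (quad1 d v + 2 * quad2 d v * d i) ^ 2 = 4 * quad2 d v * vand d * v i - quadDisc d v := by
  have := vand_mul_eq_quad d v h i
  rw [quadDisc]
  linear_combination (-4 * quad2 d v) * this

section Map

variable (φ : A →+* B) (d v : Fin 4 → A) (g : A)

lemma map_vand : φ (vand d) = vand (φ ∘ d) := by simp [vand]

lemma map_wt (i : Fin 4) : φ (wt d i) = wt (φ ∘ d) i := by
  fin_cases i <;> simp [wt]

lemma map_basePt (i : Fin 4) : φ (basePt d i) = basePt (φ ∘ d) i := by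
  simp [basePt, hsymm3, map_ofNat]

lemma map_mass (i : Fin 4) : φ (mass d i) = mass (φ ∘ d) i := by
  simp [mass, map_wt, map_basePt]

lemma map_residual (i : Fin 4) : φ (residual v g i) = residual (φ ∘ v) (φ g) i := by
  fin_cases i <;> simp [residual, map_ofNat]

lemma map_surfPt (i : Fin 4) : φ (surfPt d g i) = surfPt (φ ∘ d) (φ g) i := by
  have : φ ∘ mass d = mass (φ ∘ d) := funext (map_mass φ d)
  simp [surfPt, map_residual, map_basePt, this]

lemma map_quad2 : φ (quad2 d v) = quad2 (φ ∘ d) (φ ∘ v) := by simp [quad2, map_wt]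

lemma map_quadDisc : φ (quadDisc d v) = quadDisc (φ ∘ d) (φ ∘ v) := by
  simp [quadDisc, quad0, quad1, map_quad2, map_wt, map_vand, map_ofNat]

end Map

/-- The four nodes with parameters `p 0, p 1, p 2`, normalised by `d₁ - d₀ = 1`. -/
def nodes (p : Fin 4 → A) : Fin 4 → A := ![p 0, p 0 + 1, p 0 + p 1, p 0 + p 2]

lemma map_nodes (φ : A →+* B) (p : Fin 4 → A) : φ ∘ nodes p = nodes (φ ∘ p) := by
  ext i; fin_cases i <;> simp [nodes]

end CubicSurface

/-! ### Nonvanishing at general parameters -/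

section Nonvanishing

variable {k : Type*} [Field k]

lemma three_ne_zero_of_isPrimitiveRoot {ω : k} (hω : IsPrimitiveRoot ω 3) : (3 : k) ≠ 0 := by
  intro h3
  have h1 : ω ≠ 1 := hω.ne_one (by norm_num)
  have h : (ω - 1) ^ 3 = 0 := by linear_combination hω.pow_eq_one - (ω ^ 2 - ω) * h3
  exact h1 (sub_eq_zero.mp (pow_eq_zero_iff (by norm_num) |>.mp h))

/-- A polynomial over `k` which takes integral values with greatest common divisor `2 ^ a * 3 ^ b`
at two integral points is nonzero, because `2` and `3` are units in `k`. In the applications below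
the polynomial is defined over `ℤ`, and the points are chosen such that no other prime divides both
values; this settles all characteristics at once. -/
lemma ne_zero_of_gcd_eval {σ : Type*} (h2 : (2 : k) ≠ 0) (h3 : (3 : k) ≠ 0) {E : MvPolynomial σ k}
    {f : (σ → ℤ) → ℤ} (hf : ∀ z : σ → ℤ, MvPolynomial.eval (Int.castRingHom k ∘ z) E = f z)
    (z z' : σ → ℤ) (a b : ℕ) (h : Int.gcd (f z) (f z') = 2 ^ a * 3 ^ b) : E ≠ 0 := by
  rintro rfl
  have hz := hf z
  have hz' := hf z'
  rw [map_zero] at hz hz'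
  have h1 := congrArg (Int.cast : ℤ → k) (Int.gcd_eq_gcd_ab (f z) (f z'))
  rw [h] at h1
  push_cast at h1
  rw [← hz, ← hz', zero_mul, zero_mul, add_zero] at h1
  exact mul_ne_zero (pow_ne_zero a h2) (pow_ne_zero b h3) h1

/-- The nodes with independent variables as parameters. -/
noncomputable abbrev genNodes (k : Type*) [Field k] : Fin 4 → MvPolynomial (Fin 4) k := nodes X

lemma eval_comp_genNodes (z : Fin 4 → k) : MvPolynomial.eval z ∘ genNodes k = nodes z := by
  rw [map_nodes]; congr 1; ext i; simp

lemma eval_genNodes_int (z : Fin 4 → ℤ) :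
    MvPolynomial.eval (Int.castRingHom k ∘ z) ∘ genNodes k = Int.castRingHom k ∘ nodes z := by
  rw [eval_comp_genNodes, map_nodes]

lemma vand_genNodes_ne_zero (h2 : (2 : k) ≠ 0) (h3 : (3 : k) ≠ 0) : vand (genNodes k) ≠ 0 := by
  refine ne_zero_of_gcd_eval h2 h3 (f := fun z => vand (nodes z)) (fun z => ?_)
    ![-1, -2, -1, 0] ![-1, -2, -1, 0] 2 1 (by decide +kernel)
  rw [map_vand, eval_genNodes_int, ← map_vand, Int.coe_castRingHom]

lemma basePt_genNodes_ne_zero (h2 : (2 : k) ≠ 0) (h3 : (3 : k) ≠ 0) (i : Fin 4) :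
    basePt (genNodes k) i ≠ 0 := by
  have hf (z : Fin 4 → ℤ) : MvPolynomial.eval (Int.castRingHom k ∘ z) (basePt (genNodes k) i) =
      (basePt (nodes z) i : ℤ) := by
    rw [map_basePt, eval_genNodes_int, ← map_basePt, Int.coe_castRingHom]
  refine ne_zero_of_gcd_eval h2 h3 hf ![-1, 0, 0, 0] ![-1, 1, 1, 0] 0 0 ?_
  fin_cases i <;> decide +kernel

lemma wt_genNodes_ne_zero (h2 : (2 : k) ≠ 0) (h3 : (3 : k) ≠ 0) (i : Fin 4) :
    wt (genNodes k) i ≠ 0 := by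
  have h : wt (genNodes k) i ∣ vand (genNodes k) := by
    generalize genNodes k = d
    fin_cases i
    · exact ⟨(d 0 - d 1) * (d 0 - d 2) * (d 0 - d 3), by simp [vand, wt]; ring⟩
    · exact ⟨(d 1 - d 0) * (d 1 - d 2) * (d 1 - d 3), by simp [vand, wt]; ring⟩
    · exact ⟨(d 2 - d 0) * (d 2 - d 1) * (d 2 - d 3), by simp [vand, wt]; ring⟩
    · exact ⟨(d 3 - d 0) * (d 3 - d 1) * (d 3 - d 2), by simp [vand, wt]; ring⟩
  exact ne_zero_of_dvd_ne_zero (vand_genNodes_ne_zero h2 h3) h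

lemma mass_genNodes_ne_zero (h2 : (2 : k) ≠ 0) (h3 : (3 : k) ≠ 0) (i : Fin 4) :
    mass (genNodes k) i ≠ 0 :=
  mul_ne_zero (wt_genNodes_ne_zero h2 h3 i) (pow_ne_zero 3 (basePt_genNodes_ne_zero h2 h3 i))

lemma mass_add_mass_genNodes_ne_zero (h2 : (2 : k) ≠ 0) (h3 : (3 : k) ≠ 0) :
    mass (genNodes k) 2 + mass (genNodes k) 3 ≠ 0 := by
  refine ne_zero_of_gcd_eval h2 h3 (f := fun z => mass (nodes z) 2 + mass (nodes z) 3)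
    (fun z => ?_) ![-1, 0, 2, 0] ![-1, 0, 2, 0] 1 0 (by decide +kernel)
  rw [map_add, map_mass, map_mass, eval_genNodes_int, ← map_mass, ← map_mass, ← map_add,
    Int.coe_castRingHom]

lemma eval_surfPt_genNodes_int (z : Fin 4 → ℤ) :
    MvPolynomial.eval (Int.castRingHom k ∘ z) ∘ (fun i => surfPt (genNodes k) (X 3) i ^ 3) =
      Int.castRingHom k ∘ fun i => surfPt (nodes z) (z 3) i ^ 3 := by
  ext i
  simp only [Function.comp_apply]
  rw [map_pow, map_surfPt, eval_genNodes_int, eval_X, Function.comp_apply, ← map_surfPt, ← map_pow]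

lemma quad2_genNodes_ne_zero (h2 : (2 : k) ≠ 0) (h3 : (3 : k) ≠ 0) :
    quad2 (genNodes k) (fun i => surfPt (genNodes k) (X 3) i ^ 3) ≠ 0 := by
  refine ne_zero_of_gcd_eval h2 h3
    (f := fun z => quad2 (nodes z) (fun i => surfPt (nodes z) (z 3) i ^ 3)) (fun z => ?_)
    ![0, 2, -3, 0] ![-1, -2, -1, 0] 44 36 (by decide +kernel)
  rw [map_quad2, eval_genNodes_int, eval_surfPt_genNodes_int, ← map_quad2, Int.coe_castRingHom]

lemma quadDisc_genNodes_ne_zero (h2 : (2 : k) ≠ 0) (h3 : (3 : k) ≠ 0) :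
    quadDisc (genNodes k) (fun i => surfPt (genNodes k) (X 3) i ^ 3) ≠ 0 := by
  refine ne_zero_of_gcd_eval h2 h3
    (f := fun z => quadDisc (nodes z) (fun i => surfPt (nodes z) (z 3) i ^ 3)) (fun z => ?_)
    ![0, 2, -3, 0] ![-1, -2, -1, 0] 88 70 (by decide +kernel)
  rw [map_quadDisc, eval_genNodes_int, eval_surfPt_genNodes_int, ← map_quadDisc,
    Int.coe_castRingHom]

lemma sum_wt_mul_surfPt_zero {A : Type*} [CommRing A] (d : Fin 4 → A) :
    ∑ i, wt d i * surfPt d 0 i = 9 * (mass d 2 * mass d 3) * (wt d 2 * wt d 3) *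
      (basePt d 2 * basePt d 3) * (basePt d 2 + basePt d 3) *
      ((d 0 + d 1 + d 2 + d 3) * ((d 2 - d 3) * (d 2 + d 3))) := by
  have h := sum_wt_mul_basePt d
  have h1 : basePt d 3 - basePt d 2 =
      3 * ((d 0 + d 1 + d 2 + d 3) * ((d 2 - d 3) * (d 2 + d 3))) := by
    simp only [basePt]; ring
  have e2 : mass d 2 = wt d 2 * basePt d 2 ^ 3 := rfl
  have e3 : mass d 3 = wt d 3 * basePt d 3 ^ 3 := rfl
  simp only [Fin.sum_univ_four, surfPt, residual, Matrix.cons_val] at *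
  linear_combination (-mass d 2 * mass d 3 * (mass d 3 - mass d 2)) * h +
    3 * mass d 2 * mass d 3 * (wt d 2 * basePt d 2 * e3 - wt d 3 * basePt d 3 * e2) +
    3 * (mass d 2 * mass d 3) * (wt d 2 * wt d 3) *
      (basePt d 2 * basePt d 3) * (basePt d 2 + basePt d 3) * h1

/-- The general surface point does not lie on the tangent plane at `(1, 1, 1, 1)`. -/
lemma sum_wt_mul_surfPt_genNodes_ne_zero (h2 : (2 : k) ≠ 0) (h3 : (3 : k) ≠ 0) :
    ∑ i, wt (genNodes k) i * surfPt (genNodes k) (X 3) i ≠ 0 := by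
  intro h
  -- It suffices to specialise the last parameter to `0`, where the sum factors.
  let φ : MvPolynomial (Fin 4) k →ₐ[k] MvPolynomial (Fin 4) k := aeval ![X 0, X 1, X 2, 0]
  have hφ : φ.toRingHom ∘ genNodes k = genNodes k := by
    rw [map_nodes]
    ext i
    fin_cases i <;> simp [nodes, φ]
  have h0 : φ.toRingHom (X 3) = 0 := by simp [φ]
  have h' := congrArg φ.toRingHom h
  simp only [map_sum, map_mul, map_wt, map_surfPt, map_zero, hφ, h0] at h'
  rw [sum_wt_mul_surfPt_zero] at h'
  have hz (E : MvPolynomial (Fin 4) k) (f : (Fin 4 → ℤ) → ℤ)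
      (hf : ∀ z : Fin 4 → ℤ, MvPolynomial.eval (Int.castRingHom k ∘ z) E = f z)
      (z : Fin 4 → ℤ) (hz : Int.gcd (f z) (f z) = 2 ^ 1 * 3 ^ 0 ∨ Int.gcd (f z) (f z) = 1) :
      E ≠ 0 := by
    rcases hz with hz | hz
    · exact ne_zero_of_gcd_eval h2 h3 hf z z _ _ hz
    · exact ne_zero_of_gcd_eval h2 h3 hf z z 0 0 hz
  refine mul_ne_zero (mul_ne_zero (mul_ne_zero (mul_ne_zero (mul_ne_zero ?_ (mul_ne_zero
    (mass_genNodes_ne_zero h2 h3 2) (mass_genNodes_ne_zero h2 h3 3))) (mul_ne_zero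
    (wt_genNodes_ne_zero h2 h3 2) (wt_genNodes_ne_zero h2 h3 3))) (mul_ne_zero
    (basePt_genNodes_ne_zero h2 h3 2) (basePt_genNodes_ne_zero h2 h3 3))) ?_)
    (mul_ne_zero ?_ (mul_ne_zero ?_ ?_)) h'
  · have h9 : (9 : k) ≠ 0 := by
      rw [show (9 : k) = 3 * 3 by norm_num]
      exact mul_ne_zero h3 h3
    rw [show (9 : MvPolynomial (Fin 4) k) = C 9 from (map_ofNat C 9).symm]
    exact C_ne_zero.mpr h9
  · refine hz _ (fun z => basePt (nodes z) 2 + basePt (nodes z) 3) (fun z => ?_) ![-1, 0, 0, 0]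
      (by decide +kernel)
    rw [map_add, map_basePt, map_basePt, eval_genNodes_int, ← map_basePt, ← map_basePt, ← map_add,
      Int.coe_castRingHom]
  · refine hz _ (fun z => 4 * z 0 + 1 + z 1 + z 2) (fun z => ?_) 0 (by decide +kernel)
    simp [nodes]; ring
  · refine hz _ (fun z => z 1 - z 2) (fun z => ?_) ![0, 1, 0, 0] (by decide +kernel)
    simp [nodes]
  · refine hz _ (fun z => 2 * z 0 + z 1 + z 2) (fun z => ?_) ![0, 1, 0, 0] (by decide +kernel)
    simp [nodes]; ring

end Nonvanishing

/-! ### Recovering the parameters -/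

section Dominance

lemma basePt_add {A : Type*} [CommRing A] (α : A) (d : Fin 4 → A) (i : Fin 4) :
    basePt (fun j => α + d j) i = 8 * α ^ 3 + (12 * (d 0 + d 1 + d 2 + d 3) - 24 * d i) * α ^ 2 +
      (6 * (d 0 ^ 2 + d 1 ^ 2 + d 2 ^ 2 + d 3 ^ 2 + d 0 * d 1 + d 0 * d 2 + d 0 * d 3 + d 1 * d 2 +
        d 1 * d 3 + d 2 * d 3) - 12 * d i ^ 2 - 6 * (d 0 + d 1 + d 2 + d 3) * d i) * α +
      basePt d i := by
  simp only [basePt, hsymm3]; ring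

/-- The difference of the nodes from the first one. -/
def shape {A : Type*} [CommRing A] (p : Fin 4 → A) : Fin 4 → A := ![0, 1, p 1, p 2]

lemma nodes_eq_add_shape {A : Type*} [CommRing A] (p : Fin 4 → A) :
    nodes p = fun j => p 0 + shape p j := by
  ext j; fin_cases j <;> simp [nodes, shape]

lemma wt_add {A : Type*} [CommRing A] (α : A) (d : Fin 4 → A) :
    wt (fun j => α + d j) = wt d := by
  ext i; fin_cases i <;> simp [wt]

variable {Ω : Type*} [Field Ω] (M : Subfield Ω)

lemma wt_mem {d : Fin 4 → Ω} (hd : ∀ i, d i ∈ M) (i : Fin 4) : wt d i ∈ M := by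
  lift d to Fin 4 → M using hd
  rw [show (fun i => (d i : Ω)) = M.subtype ∘ d from rfl, ← map_wt]
  exact (wt d i).2

lemma basePt_mem {d : Fin 4 → Ω} (hd : ∀ i, d i ∈ M) (i : Fin 4) : basePt d i ∈ M := by
  lift d to Fin 4 → M using hd
  rw [show (fun i => (d i : Ω)) = M.subtype ∘ d from rfl, ← map_basePt]
  exact (basePt d i).2

/-- If `x` lies on the tangent plane to the cubic surface at the base point for the nodes `α + dᵢ`,
and `x` and `d` have coordinates in the relatively algebraically closed subfield `M`, then `α` lies
in `M`. Indeed, the equation of the tangent plane is a polynomial equation for `α` of degree at most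
`6`, whose leading coefficient `64 * ∑ wt d i * x i` does not vanish. -/
lemma shift_mem {α : Ω} {d x : Fin 4 → Ω} (h2 : (2 : Ω) ≠ 0) (hM : ∀ z, IsAlgebraic M z → z ∈ M)
    (hd : ∀ i, d i ∈ M) (hx : ∀ i, x i ∈ M)
    (h : ∑ i, wt d i * basePt (fun j => α + d j) i ^ 2 * x i = 0)
    (hN : ∑ i, wt d i * x i ≠ 0) : α ∈ M := by
  refine hM α ?_
  have hc (i : Fin 4) : ∃ c : M, (c : Ω) = wt d i * x i :=
    ⟨⟨_, mul_mem (wt_mem M hd i) (hx i)⟩, rfl⟩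
  have hb (i : Fin 4) : ∃ b : M, (b : Ω) = basePt d i := ⟨⟨_, basePt_mem M hd i⟩, rfl⟩
  have hu (i : Fin 4) : ∃ b : M, (b : Ω) = 12 * (d 0 + d 1 + d 2 + d 3) - 24 * d i := by
    lift d to Fin 4 → M using hd
    exact ⟨12 * (d 0 + d 1 + d 2 + d 3) - 24 * d i, rfl⟩
  have hv (i : Fin 4) : ∃ b : M, (b : Ω) = 6 * (d 0 ^ 2 + d 1 ^ 2 + d 2 ^ 2 + d 3 ^ 2 + d 0 * d 1 +
      d 0 * d 2 + d 0 * d 3 + d 1 * d 2 + d 1 * d 3 + d 2 * d 3) - 12 * d i ^ 2 -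
      6 * (d 0 + d 1 + d 2 + d 3) * d i := by
    lift d to Fin 4 → M using hd
    exact ⟨6 * (d 0 ^ 2 + d 1 ^ 2 + d 2 ^ 2 + d 3 ^ 2 + d 0 * d 1 +
      d 0 * d 2 + d 0 * d 3 + d 1 * d 2 + d 1 * d 3 + d 2 * d 3) - 12 * d i ^ 2 -
      6 * (d 0 + d 1 + d 2 + d 3) * d i, rfl⟩
  choose c hc using hc
  choose b hb using hb
  choose u hu using hu
  choose v hv using hv
  let q (i : Fin 4) : Polynomial M := .C 8 * .X ^ 3 + .C (u i) * .X ^ 2 + .C (v i) * .X + .C (b i)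
  have hq (i : Fin 4) : Polynomial.aeval α (q i) = basePt (fun j => α + d j) i := by
    simp only [q, map_add, map_mul, map_pow, Polynomial.aeval_C, Polynomial.aeval_X, basePt_add,
      map_ofNat]
    simp only [Subfield.algebraMap_ofSubfield, Subfield.subtype_apply, hu, hv, hb]
  have hdeg (i : Fin 4) : (q i).natDegree ≤ 3 := by simp only [q]; compute_degree
  have hcoeff (i : Fin 4) : (q i).coeff 3 = 8 := by
    simp [q]
  refine ⟨∑ i, .C (c i) * q i ^ 2, fun h0 => hN ?_, ?_⟩
  · have h6 := congrArg (fun P => Polynomial.coeff P 6) h0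
    have h64 (i : Fin 4) : (q i ^ 2).coeff 6 = 64 := by
      rw [show 6 = 2 * 3 from rfl, Polynomial.coeff_pow_of_natDegree_le (hdeg i), hcoeff]
      norm_num
    simp only [Polynomial.finsetSum_coeff, Polynomial.coeff_C_mul, h64, Polynomial.coeff_zero,
      ← Finset.sum_mul] at h6
    have h6' := congrArg (M.subtype) h6
    simp only [map_mul, map_sum, map_ofNat, Subfield.subtype_apply, hc, map_zero] at h6'
    refine (mul_eq_zero.mp h6').resolve_right ?_
    rw [show (64 : Ω) = 2 ^ 6 by norm_num]
    exact pow_ne_zero 6 h2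
  · rw [map_sum, ← h]
    refine Finset.sum_congr rfl fun i _ => ?_
    rw [map_mul, map_pow, hq, Polynomial.aeval_C, Subfield.algebraMap_ofSubfield,
      Subfield.subtype_apply, hc]
    ring

/-- The parameters of the family of surface points lie in every relatively algebraically closed
subfield `M` that contains the coordinates of the four points constructed from them on a sextic
twist of `E(6)`. The `y`-coordinates are an affine function of the nodes, so their differences
determine the shape of the nodes; the equation of the tangent plane determines their position; the
last parameter is a ratio of differences of `x`-coordinates. -/
lemma params_mem {p : Fin 4 → Ω} (h2 : (2 : Ω) ≠ 0) (hM : ∀ z, IsAlgebraic M z → z ∈ M)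
    {t r : Ω} (ht : t ≠ 0) (hr : r ≠ 0) (hb : ∀ i, basePt (nodes p) i ≠ 0)
    (hm : mass (nodes p) 2 + mass (nodes p) 3 ≠ 0)
    (hN : ∑ i, wt (nodes p) i * surfPt (nodes p) (p 3) i ≠ 0) {A₁ A₂ : Ω} (hA : A₂ ≠ 0)
    (hx : ∀ i, t * surfPt (nodes p) (p 3) i ∈ M) (hy : ∀ i, r * (A₁ + 2 * A₂ * nodes p i) ∈ M)
    (i : Fin 4) : p i ∈ M := by
  have hrA : 2 * r * A₂ ≠ 0 := mul_ne_zero (mul_ne_zero h2 hr) hA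
  have key (i : Fin 4) : shape p i ∈ M := by
    have h : shape p i = (r * (A₁ + 2 * A₂ * nodes p i) - r * (A₁ + 2 * A₂ * nodes p 0)) /
        (r * (A₁ + 2 * A₂ * nodes p 1) - r * (A₁ + 2 * A₂ * nodes p 0)) := by
      have e1 : r * (A₁ + 2 * A₂ * nodes p 1) - r * (A₁ + 2 * A₂ * nodes p 0) = 2 * r * A₂ := by
        simp [nodes]; ring
      rw [e1, eq_div_iff hrA]
      fin_cases i <;> simp [nodes, shape] <;> ring
    rw [h]
    exact div_mem (sub_mem (hy i) (hy 0)) (sub_mem (hy 1) (hy 0))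
  have hwt : wt (nodes p) = wt (shape p) := by rw [nodes_eq_add_shape, wt_add]
  have h0 : p 0 ∈ M := by
    refine shift_mem M h2 hM key hx (α := p 0) ?_ ?_
    · rw [← nodes_eq_add_shape, ← hwt]
      calc _ = t * ∑ i, wt (nodes p) i * basePt (nodes p) i ^ 2 * surfPt (nodes p) (p 3) i := by
            rw [Finset.mul_sum]; exact Finset.sum_congr rfl fun _ _ => by ring
        _ = 0 := by rw [sum_wt_mul_basePt_sq_mul_surfPt, mul_zero]
    · rw [← hwt]
      have : ∑ i, wt (nodes p) i * (t * surfPt (nodes p) (p 3) i) =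
          t * ∑ i, wt (nodes p) i * surfPt (nodes p) (p 3) i := by
        rw [Finset.mul_sum]; exact Finset.sum_congr rfl fun _ _ => by ring
      rw [this]
      exact mul_ne_zero ht hN
  have hnodes (i : Fin 4) : nodes p i ∈ M := by
    rw [nodes_eq_add_shape]; exact add_mem h0 (key i)
  have hres (i : Fin 4) : t * residual (mass (nodes p)) (p 3) i ∈ M := by
    have := div_mem (hx i) (basePt_mem M hnodes i)
    rwa [surfPt, mul_left_comm, mul_div_cancel_left₀ _ (hb i)] at this
  have h3 : p 3 ∈ M := by
    have hsum := sum_mass (nodes p)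
    have hbase := sum_wt_mul_basePt (nodes p)
    simp only [surfPt] at hN
    generalize mass (nodes p) = m at *
    generalize basePt (nodes p) = b at *
    generalize wt (nodes p) = w at *
    generalize p 3 = g at *
    simp only [Fin.sum_univ_four] at hsum hbase hN
    have hQ : 3 * (g ^ 2 * m 0 * m 1 - m 2 * m 3) ≠ 0 := by
      intro h
      apply hN
      simp only [residual, h, zero_mul, sub_zero]
      linear_combination (g ^ 3 * m 0 * m 1 * (m 1 - m 0) - m 2 * m 3 * (m 3 - m 2)) * hbase
    have e : t * residual m g 2 - t * residual m g 3 =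
        -(t * (3 * (g ^ 2 * m 0 * m 1 - m 2 * m 3)) * (m 2 + m 3)) := by
      simp [residual]; ring
    have hne : t * residual m g 2 - t * residual m g 3 ≠ 0 := by
      rw [e]; exact neg_ne_zero.mpr (mul_ne_zero (mul_ne_zero ht hQ) hm)
    have hg : g = -((t * residual m g 0 - t * residual m g 1) /
        (t * residual m g 2 - t * residual m g 3)) := by
      rw [← neg_div, eq_div_iff hne, e]
      simp only [residual, Matrix.cons_val]
      linear_combination (-g * t * 3 * (g ^ 2 * m 0 * m 1 - m 2 * m 3)) * hsum
    rw [hg]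
    exact neg_mem (div_mem (sub_mem (hres 0) (hres 1)) (sub_mem (hres 2) (hres 3)))
  fin_cases i
  · exact h0
  · exact key 2
  · exact key 3
  · exact h3

end Dominance

/-! ### Four points on a sextic twist -/

section TwistPoints

variable (k : Type u) [Field k]

/-- The function field of affine fourspace. -/
abbrev RatField : Type u := FractionRing (MvPolynomial (Fin 4) k)

variable {k}

/-- A family of elements of an algebraic extension of `RatField k` is algebraically independent as
soon as every relatively algebraically closed subfield containing `k` and the family contains the
four variables. -/
lemma algebraicIndependent_of_forall_mem {Ω : Type u} [Field Ω] [Algebra k Ω]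
    [Algebra (RatField k) Ω] [IsScalarTower k (RatField k) Ω] [Algebra.IsAlgebraic (RatField k) Ω]
    (z : Fin 4 → Ω)
    (h : ∀ M : Subfield Ω, (∀ w, IsAlgebraic M w → w ∈ M) → (∀ i, z i ∈ M) →
      ∀ i, algebraMap (RatField k) Ω (algebraMap (MvPolynomial (Fin 4) k) _ (X i)) ∈ M) :
    AlgebraicIndependent k z := by
  let K := IntermediateField.adjoin k (Set.range z)
  let M := algebraicClosure K Ω
  have hM : ∀ w, IsAlgebraic M w → w ∈ M := fun w hw =>
    mem_algebraicClosure_iff.mpr (hw.restrictScalars K)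
  have hp := h M.toSubfield hM fun i => by
    have : z i ∈ K := IntermediateField.subset_adjoin _ _ ⟨i, rfl⟩
    exact M.algebraMap_mem ⟨z i, this⟩
  have hkM (c : k) : algebraMap k Ω c ∈ M :=
    M.algebraMap_mem ⟨algebraMap k Ω c, K.algebraMap_mem c⟩
  have hpoly (q : MvPolynomial (Fin 4) k) : algebraMap (RatField k) Ω (algebraMap _ _ q) ∈ M := by
    induction q using MvPolynomial.induction_on with
    | C c =>
      have : algebraMap (RatField k) Ω (algebraMap (MvPolynomial (Fin 4) k) (RatField k) (C c)) =
          algebraMap k Ω c := by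
        rw [IsScalarTower.algebraMap_apply k (RatField k) Ω,
          IsScalarTower.algebraMap_apply k (MvPolynomial (Fin 4) k) (RatField k)]
        rfl
      rw [this]
      exact hkM c
    | add p q hp hq => rw [map_add, map_add]; exact add_mem hp hq
    | mul_X p i hq => rw [map_mul, map_mul]; exact mul_mem hq (hp i)
  have hF (f : RatField k) : algebraMap (RatField k) Ω f ∈ M := by
    obtain ⟨a, b, -, rfl⟩ := IsFractionRing.div_surjective (A := MvPolynomial (Fin 4) k) f
    rw [map_div₀]
    exact div_mem (hpoly a) (hpoly b)
  have hall (w : Ω) : IsAlgebraic K w := by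
    refine mem_algebraicClosure_iff.mp (hM w ?_)
    obtain ⟨P, hP, hw⟩ := Algebra.IsAlgebraic.isAlgebraic (R := RatField k) w
    let φ : RatField k →+* M := (algebraMap (RatField k) Ω).codRestrict M hF
    refine ⟨P.map φ, (Polynomial.map_ne_zero_iff φ.injective).mpr hP, ?_⟩
    rw [Polynomial.aeval_def, Polynomial.eval₂_map]
    exact hw
  have : Algebra.IsAlgebraic K Ω := ⟨hall⟩
  have halg : Algebra.IsAlgebraic (Algebra.adjoin k (Set.range z)) Ω :=
    ⟨fun w => (IntermediateField.isAlgebraic_adjoin_iff).mp (hall w)⟩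
  refine (Algebra.IsAlgebraic.isTranscendenceBasis_of_lift_le_trdeg_of_finite k z ?_).1
  have hX : AlgebraicIndependent k fun i : Fin 4 =>
      algebraMap (RatField k) Ω (algebraMap (MvPolynomial (Fin 4) k) _ (X i)) := by
    let ψ : MvPolynomial (Fin 4) k →ₐ[k] Ω := (IsScalarTower.toAlgHom k (RatField k) Ω).comp
      (IsScalarTower.toAlgHom k (MvPolynomial (Fin 4) k) (RatField k))
    have hψ : Function.Injective ψ := (algebraMap (RatField k) Ω).injective.comp
      (IsFractionRing.injective (MvPolynomial (Fin 4) k) (RatField k))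
    exact (MvPolynomial.algebraicIndependent_X (Fin 4) k).map' (f := ψ) hψ
  exact hX.lift_cardinalMk_le_trdeg

/-- Over the function field of affine fourspace, a sextic twist of the affine curve `y² = x³ - 1`
has four points whose `x`-coordinates become algebraically independent when the twist is
trivialised. -/
theorem exists_twist_points (h2 : (2 : k) ≠ 0) (h3 : (3 : k) ≠ 0) :
    ∃ (κ : RatField k) (x y : Fin 4 → RatField k),
      (∀ i, κ * y i ^ 2 = κ * x i ^ 3 - 1) ∧
      ∀ (Ω : Type u) [Field Ω] [Algebra k Ω] [Algebra (RatField k) Ω]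
        [IsScalarTower k (RatField k) Ω] [Algebra.IsAlgebraic (RatField k) Ω] (θ : Ω),
        θ ^ 6 = algebraMap _ Ω κ →
          AlgebraicIndependent k fun i => θ ^ 2 * algebraMap _ Ω (x i) := by
  let ι := algebraMap (MvPolynomial (Fin 4) k) (RatField k)
  have hι : Function.Injective ι := IsFractionRing.injective _ _
  have hne {q : MvPolynomial (Fin 4) k} (hq : q ≠ 0) : ι q ≠ 0 := (map_ne_zero_iff ι hι).mpr hq
  let p : Fin 4 → RatField k := fun i => ι (X i)
  have hnodes : ι ∘ genNodes k = nodes p := map_nodes ι X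
  let s : Fin 4 → RatField k := surfPt (nodes p) (p 3)
  have hs (i : Fin 4) : ι (surfPt (genNodes k) (X 3) i) = s i := by rw [map_surfPt, hnodes]
  have hs3 : ι ∘ (fun i => surfPt (genNodes k) (X 3) i ^ 3) = fun i => s i ^ 3 := by
    ext i; simp only [Function.comp_apply, map_pow, hs]
  have hV : vand (nodes p) ≠ 0 := by
    rw [← hnodes, ← map_vand]; exact hne (vand_genNodes_ne_zero h2 h3)
  have hA : quad2 (nodes p) (fun i => s i ^ 3) ≠ 0 := by
    rw [← hnodes, ← hs3, ← map_quad2]; exact hne (quad2_genNodes_ne_zero h2 h3)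
  have hD : quadDisc (nodes p) (fun i => s i ^ 3) ≠ 0 := by
    rw [← hnodes, ← hs3, ← map_quadDisc]; exact hne (quadDisc_genNodes_ne_zero h2 h3)
  have hb (i : Fin 4) : basePt (nodes p) i ≠ 0 := by
    rw [← hnodes, ← map_basePt]; exact hne (basePt_genNodes_ne_zero h2 h3 i)
  have hm : mass (nodes p) 2 + mass (nodes p) 3 ≠ 0 := by
    rw [← hnodes, ← map_mass, ← map_mass, ← map_add]
    exact hne (mass_add_mass_genNodes_ne_zero h2 h3)
  have hN : ∑ i, wt (nodes p) i * s i ≠ 0 := by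
    have := hne (sum_wt_mul_surfPt_genNodes_ne_zero h2 h3)
    simpa only [map_sum, map_mul, hs, map_wt, hnodes] using this
  have hsquare := quad_complete_square (nodes p) (fun i => s i ^ 3)
    (sum_wt_mul_surfPt_pow_three (nodes p) (p 3))
  generalize quad2 (nodes p) (fun i => s i ^ 3) = A₂ at *
  generalize quad1 (nodes p) (fun i => s i ^ 3) = A₁ at *
  generalize quadDisc (nodes p) (fun i => s i ^ 3) = D at *
  have h2F : (2 : RatField k) ≠ 0 := by
    rw [← map_ofNat (algebraMap k (RatField k)) 2]
    exact (map_ne_zero _).mpr h2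
  -- The points satisfy `Y ^ 2 = l * X ^ 3 - D`; scaling by `l` makes both leading coefficients `1`.
  let l := 4 * A₂ * vand (nodes p)
  have hl : l ≠ 0 := mul_ne_zero (mul_ne_zero (by
    rw [show (4 : RatField k) = 2 * 2 by norm_num]; exact mul_ne_zero h2F h2F) hA) hV
  have heq (i : Fin 4) : (D * l ^ 2)⁻¹ * (l * (A₁ + 2 * A₂ * nodes p i)) ^ 2 =
      (D * l ^ 2)⁻¹ * (l * s i) ^ 3 - 1 := by
    have h : (l * (A₁ + 2 * A₂ * nodes p i)) ^ 2 = (l * s i) ^ 3 - D * l ^ 2 := by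
      rw [mul_pow, hsquare i]; simp only [l]; ring
    rw [h, mul_sub, inv_mul_cancel₀ (mul_ne_zero hD (pow_ne_zero 2 hl))]
  refine ⟨(D * l ^ 2)⁻¹, fun i => l * s i, fun i => l * (A₁ + 2 * A₂ * nodes p i),
    heq, ?_⟩
  · intro Ω _ _ _ _ _ θ hθ
    have hθ0 : θ ≠ 0 := by
      rintro rfl
      refine inv_ne_zero (mul_ne_zero hD (pow_ne_zero 2 hl))
        ((map_eq_zero (algebraMap (RatField k) Ω)).mp ?_)
      rw [← hθ]; simp
    refine algebraicIndependent_of_forall_mem _ fun M hM hz i => ?_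
    let τ := algebraMap (RatField k) Ω
    have hτ {q : RatField k} (hq : q ≠ 0) : τ q ≠ 0 := (map_ne_zero τ).mpr hq
    have hτn : τ ∘ nodes p = nodes (τ ∘ p) := map_nodes τ p
    have hτs (i : Fin 4) : τ (s i) = surfPt (nodes (τ ∘ p)) ((τ ∘ p) 3) i := by
      rw [map_surfPt, hτn]; rfl
    refine params_mem M (p := τ ∘ p) (t := θ ^ 2 * τ l) (r := θ ^ 3 * τ l) (A₁ := τ A₁)
      (A₂ := τ A₂) ?_ hM (mul_ne_zero (pow_ne_zero 2 hθ0) (hτ hl))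
      (mul_ne_zero (pow_ne_zero 3 hθ0) (hτ hl)) (fun i => ?_) ?_ ?_ (hτ hA) (fun i => ?_)
      (fun i => ?_) i
    · rw [← map_ofNat τ 2]; exact hτ h2F
    · rw [← hτn, ← map_basePt]; exact hτ (hb i)
    · rw [← hτn, ← map_mass, ← map_mass, ← map_add]; exact hτ hm
    · simpa only [map_sum, map_mul, map_wt, hτn, hτs] using hτ hN
    · rw [← hτs, mul_assoc, ← map_mul]; exact hz i
    · -- The square of this element is determined by the `x`-coordinate.
      refine hM _ (IsAlgebraic.of_pow two_pos ?_)
      have h : (θ ^ 3 * τ l * (τ A₁ + 2 * τ A₂ * nodes (τ ∘ p) i)) ^ 2 =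
          (θ ^ 2 * τ (l * s i)) ^ 3 - 1 := by
        have h1 := congrArg τ (heq i)
        have h3 : nodes (τ ∘ p) i = τ (nodes p i) := (congrFun hτn i).symm
        simp only [map_mul, map_sub, map_pow, map_one, map_add, map_ofNat] at h1 ⊢
        rw [show τ (D * l ^ 2)⁻¹ = θ ^ 6 from hθ.symm] at h1
        rw [h3]
        linear_combination h1
      rw [h]
      exact isAlgebraic_algebraMap (⟨_, sub_mem (pow_mem (hz i) 3) (one_mem M)⟩ : M)

end TwistPoints

/-! ### Functions on products of the affine curve -/

section CurveProducts

/-- `X ^ 3 - 1` has odd degree, hence is not a square of a rational function. -/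
lemma eq_zero_of_sq_eq_sq_mul {K : Type*} [Field K] {P Q : Polynomial K}
    (h : P ^ 2 = Q ^ 2 * (.X ^ 3 - 1)) : P = 0 ∧ Q = 0 := by
  have hX : (.X ^ 3 - 1 : Polynomial K).natDegree = 3 := by
    rw [← Polynomial.C_1]; exact Polynomial.natDegree_X_pow_sub_C
  have hX0 : (.X ^ 3 - 1 : Polynomial K) ≠ 0 := by
    intro h0; rw [h0] at hX; simp at hX
  by_cases hQ : Q = 0
  · subst hQ
    exact ⟨by simpa using h, rfl⟩
  · exfalso
    have h' := congrArg Polynomial.natDegree h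
    rw [Polynomial.natDegree_pow, Polynomial.natDegree_mul (pow_ne_zero 2 hQ) hX0,
      Polynomial.natDegree_pow, hX] at h'
    omega

variable {k T Ω : Type*} [Field k] [CommRing T] [Algebra k T] [Field Ω] [Algebra k Ω]

/-- Adjoining the coordinates of a point of `y² = x³ - 1` whose `x`-coordinate has transcendental
image preserves injectivity of a homomorphism to a field. -/
lemma injOn_sup_adjoin_point (ψ : T →ₐ[k] Ω) (S : Subalgebra k T) (K : Subfield Ω)
    (hS : ∀ s ∈ S, ψ s = 0 → s = 0) (hK : ∀ s ∈ S, ψ s ∈ K) {x y : T} (hxy : y ^ 2 = x ^ 3 - 1)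
    (hx : Transcendental K (ψ x)) (s : T) (hs : s ∈ S ⊔ Algebra.adjoin k {x, y}) (h : ψ s = 0) :
    s = 0 := by
  have hform : ∃ p q : Polynomial S, s = Polynomial.aeval x p + Polynomial.aeval x q * y := by
    clear h
    rw [← Algebra.adjoin_eq S, ← Algebra.adjoin_union] at hs
    induction hs using Algebra.adjoin_induction with
    | mem t ht =>
      rcases ht with ht | rfl | rfl
      · exact ⟨.C ⟨t, ht⟩, 0, by simp⟩
      · exact ⟨.X, 0, by simp⟩
      · exact ⟨0, 1, by simp⟩
    | algebraMap c => exact ⟨.C (algebraMap k S c), 0, by simp⟩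
    | add a b _ _ ha hb =>
      obtain ⟨p, q, rfl⟩ := ha
      obtain ⟨p', q', rfl⟩ := hb
      exact ⟨p + p', q + q', by simp only [map_add]; ring⟩
    | mul a b _ _ ha hb =>
      obtain ⟨p, q, rfl⟩ := ha
      obtain ⟨p', q', rfl⟩ := hb
      refine ⟨p * p' + q * q' * (.X ^ 3 - 1), p * q' + q * p', ?_⟩
      simp only [map_add, map_mul, map_sub, map_pow, map_one, Polynomial.aeval_X]
      linear_combination Polynomial.aeval x q * Polynomial.aeval x q' * hxy
  obtain ⟨p, q, rfl⟩ := hform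
  let φ : S →+* K := ((ψ : T →+* Ω).comp S.val.toRingHom).codRestrict K fun s => hK s s.2
  have hφ : Function.Injective φ := by
    rw [injective_iff_map_eq_zero]
    intro s hs
    exact Subtype.ext (hS s s.2 (congrArg Subtype.val hs))
  have hmap (r : Polynomial S) :
      ψ (Polynomial.aeval x r) = Polynomial.aeval (ψ x) (r.map φ) := by
    rw [Polynomial.aeval_def, Polynomial.aeval_def, Polynomial.eval₂_map]
    exact Polynomial.hom_eval₂ r (algebraMap S T) (ψ : T →+* Ω) x
  rw [map_add, map_mul, hmap, hmap] at h
  have hxy' := congrArg ψ hxy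
  simp only [map_sub, map_pow, map_one] at hxy'
  have hsq : (p.map φ) ^ 2 = (q.map φ) ^ 2 * (.X ^ 3 - 1) := by
    rw [← sub_eq_zero]
    by_contra hne
    refine hx ⟨_, hne, ?_⟩
    simp only [map_sub, map_mul, map_pow, map_one, Polynomial.aeval_X]
    linear_combination (Polynomial.aeval (ψ x) (p.map φ) -
      Polynomial.aeval (ψ x) (q.map φ) * ψ y) * h +
      Polynomial.aeval (ψ x) (q.map φ) ^ 2 * hxy'
  obtain ⟨hp, hq⟩ := eq_zero_of_sq_eq_sq_mul hsq
  rw [(Polynomial.map_eq_zero_iff hφ).mp hp, (Polynomial.map_eq_zero_iff hφ).mp hq]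
  simp

/-- A homomorphism to a field from an algebra generated by points of `y² = x³ - 1` is injective if
the images of the `x`-coordinates are algebraically independent. -/
theorem injective_of_adjoin_points {n : ℕ} (ψ : T →ₐ[k] Ω) (x y : Fin n → T)
    (hxy : ∀ i, y i ^ 2 = x i ^ 3 - 1)
    (hT : Algebra.adjoin k (Set.range x ∪ Set.range y) = ⊤)
    (hx : AlgebraicIndependent k fun i => ψ (x i)) : Function.Injective ψ := by
  let S (m : ℕ) : Subalgebra k T := Algebra.adjoin k {t | ∃ i : Fin n, i < m ∧ (t = x i ∨ t = y i)}
  have key (m : ℕ) : ∀ s ∈ S m, ψ s = 0 → s = 0 := by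
    induction m with
    | zero =>
      intro s hs h
      have : s ∈ (⊥ : Subalgebra k T) := by simpa [S] using hs
      obtain ⟨c, rfl⟩ := Algebra.mem_bot.mp this
      rw [AlgHom.commutes, map_eq_zero] at h
      rw [h, map_zero]
    | succ m ih =>
      by_cases hm : m < n
      · let A := Algebra.adjoin k ((fun i => ψ (x i)) '' {i : Fin n | i < m})
        let F := IntermediateField.adjoin k ((fun i => ψ (x i)) '' {i : Fin n | i < m})
        let K := algebraicClosure F Ω
        have hFK (z : Ω) (hz : z ∈ F) : z ∈ K := K.algebraMap_mem ⟨z, hz⟩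
        have hxK (i : Fin n) (hi : i < m) : ψ (x i) ∈ K :=
          hFK _ (IntermediateField.subset_adjoin _ _ ⟨i, hi, rfl⟩)
        have hyK (i : Fin n) (hi : i < m) : ψ (y i) ∈ K := by
          refine mem_algebraicClosure_iff.mpr (IsAlgebraic.of_pow two_pos ?_)
          rw [← map_pow, hxy, map_sub, map_pow, map_one]
          exact mem_algebraicClosure_iff.mp (sub_mem (pow_mem (hxK i hi) 3) (one_mem K))
        have hK (s : T) (hs : s ∈ S m) : ψ s ∈ K := by
          induction hs using Algebra.adjoin_induction with
          | mem t ht =>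
            obtain ⟨i, hi, rfl | rfl⟩ := ht
            exacts [hxK i hi, hyK i hi]
          | algebraMap c => rw [AlgHom.commutes]; exact hFK _ (F.algebraMap_mem c)
          | add a b _ _ ha hb => rw [map_add]; exact add_mem ha hb
          | mul a b _ _ ha hb => rw [map_mul]; exact mul_mem ha hb
        have htr : Transcendental K (ψ (x ⟨m, hm⟩)) := by
          intro halg
          have h1 : IsAlgebraic F (ψ (x ⟨m, hm⟩)) := halg.restrictScalars F
          rw [IntermediateField.isAlgebraic_adjoin_iff] at h1
          exact hx.transcendental_adjoin (i := ⟨m, hm⟩) (s := {i : Fin n | i < m}) (by simp) h1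
        intro s hs h
        refine injOn_sup_adjoin_point ψ (S m) K.toSubfield ih hK (hxy ⟨m, hm⟩) htr s ?_ h
        refine (Algebra.adjoin_le (S := S m ⊔ _) ?_) hs
        rintro t ⟨i, hi, ht⟩
        rcases Nat.lt_succ_iff_lt_or_eq.mp hi with hi | hi
        · exact (le_sup_left : S m ≤ _) (Algebra.subset_adjoin ⟨i, hi, ht⟩)
        · obtain rfl : i = ⟨m, hm⟩ := Fin.ext hi
          exact (le_sup_right : Algebra.adjoin k _ ≤ _) (Algebra.subset_adjoin ht)
      · intro s hs h
        refine ih s ((Algebra.adjoin_mono ?_) hs) h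
        rintro t ⟨i, -, ht⟩
        exact ⟨i, by omega, ht⟩
  rw [injective_iff_map_eq_zero]
  intro s
  have hs : s ∈ Algebra.adjoin k (Set.range x ∪ Set.range y) := hT ▸ Algebra.mem_top
  refine key n s (Algebra.adjoin_mono ?_ hs)
  rintro t (⟨i, rfl⟩ | ⟨i, rfl⟩)
  exacts [⟨i, i.2, .inl rfl⟩, ⟨i, i.2, .inr rfl⟩]

end CurveProducts

/-! ### Kummer rings and descent along finite cyclic groups -/

section Kummer

variable {F : Type u} [Field F]

/-- The cover of the point `Spec F` over which the sextic twist by `κ` becomes trivial. -/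
abbrev KummerRing (κ : F) : Type u := AdjoinRoot (Polynomial.X ^ 6 - Polynomial.C κ : Polynomial F)

/-- The canonical sixth root of `κ`. -/
noncomputable abbrev kummerRoot (κ : F) : KummerRing κ := AdjoinRoot.root _

lemma kummerRoot_pow (κ : F) : kummerRoot κ ^ 6 = algebraMap F (KummerRing κ) κ := by
  have h := AdjoinRoot.eval₂_root (Polynomial.X ^ 6 - Polynomial.C κ : Polynomial F)
  rw [Polynomial.eval₂_sub, Polynomial.eval₂_X_pow, Polynomial.eval₂_C, sub_eq_zero] at h
  exact h

lemma kummerRing_nontrivial (κ : F) : Nontrivial (KummerRing κ) := by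
  refine AdjoinRoot.nontrivial _ ?_
  rw [Polynomial.degree_X_pow_sub_C (by norm_num)]
  norm_num

/-- A sixth root of `κ` in an `F`-algebra defines a homomorphism from the Kummer ring. -/
noncomputable def kummerLift {κ : F} {B : Type*} [CommRing B] [Algebra F B] (θ : B)
    (hθ : θ ^ 6 = algebraMap F B κ) : KummerRing κ →ₐ[F] B :=
  AdjoinRoot.liftAlgHom _ (Algebra.ofId F B) θ (by
    rw [Polynomial.eval₂_sub, Polynomial.eval₂_X_pow, Polynomial.eval₂_C]
    exact sub_eq_zero.mpr hθ)

@[simp] lemma kummerLift_root {κ : F} {B : Type*} [CommRing B] [Algebra F B] (θ : B)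
    (hθ : θ ^ 6 = algebraMap F B κ) : kummerLift θ hθ (kummerRoot κ) = θ :=
  AdjoinRoot.liftAlgHom_root ..

lemma kummer_algHom_ext {κ : F} {B : Type*} [CommRing B] [Algebra F B] {f g : KummerRing κ →ₐ[F] B}
    (h : f (kummerRoot κ) = g (kummerRoot κ)) : f = g :=
  AdjoinRoot.algHom_ext h

lemma algebraMap_mul_root_pow {κ ζ : F} (hζ : ζ ^ 6 = 1) :
    (algebraMap F (KummerRing κ) ζ * kummerRoot κ) ^ 6 = algebraMap F _ κ := by
  rw [mul_pow, ← map_pow, hζ, map_one, one_mul, kummerRoot_pow]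

/-- The automorphism of the Kummer ring multiplying the sixth root of `κ` by a sixth root of
unity. -/
noncomputable def kummerAut (κ : F) {ζ : F} (hζ : ζ ^ 6 = 1) : KummerRing κ ≃ₐ[F] KummerRing κ :=
  AlgEquiv.ofAlgHom
    (kummerLift (algebraMap F _ ζ * kummerRoot κ) (algebraMap_mul_root_pow hζ))
    (kummerLift (algebraMap F _ (ζ ^ 5) * kummerRoot κ)
      (algebraMap_mul_root_pow (by rw [← pow_mul, mul_comm, pow_mul, hζ, one_pow])))
    (kummer_algHom_ext (by
      rw [AlgHom.comp_apply, kummerLift_root, map_mul, AlgHom.commutes, kummerLift_root,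
        ← mul_assoc, ← map_mul, ← pow_succ, hζ, map_one, one_mul, AlgHom.id_apply]))
    (kummer_algHom_ext (by
      rw [AlgHom.comp_apply, kummerLift_root, map_mul, AlgHom.commutes, kummerLift_root,
        ← mul_assoc, ← map_mul, ← pow_succ', hζ, map_one, one_mul, AlgHom.id_apply]))

@[simp] lemma kummerAut_root (κ : F) {ζ : F} (hζ : ζ ^ 6 = 1) :
    kummerAut κ hζ (kummerRoot κ) = algebraMap F _ ζ * kummerRoot κ :=
  kummerLift_root _ (algebraMap_mul_root_pow hζ)

lemma kummerAut_pow_root (κ : F) {ζ : F} (hζ : ζ ^ 6 = 1) (n : ℕ) :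
    (kummerAut κ hζ ^ n) (kummerRoot κ) = algebraMap F _ (ζ ^ n) * kummerRoot κ := by
  induction n with
  | zero => simp
  | succ n ih =>
    rw [pow_succ' (kummerAut κ hζ) n, AlgEquiv.mul_apply, ih, map_mul, AlgEquiv.commutes,
      kummerAut_root, ← mul_assoc, ← map_mul, ← pow_succ ζ]

lemma kummerAut_pow_six (κ : F) {ζ : F} (hζ : ζ ^ 6 = 1) : kummerAut κ hζ ^ 6 = 1 := by
  refine AlgEquiv.coe_toAlgHom_injective (kummer_algHom_ext ?_)
  simp [kummerAut_pow_root, hζ]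

lemma finite_zpowers_kummerAut (κ : F) {ζ : F} (hζ : ζ ^ 6 = 1) :
    Finite (Subgroup.zpowers (kummerAut κ hζ)) := by
  have : IsOfFinOrder (kummerAut κ hζ) :=
    isOfFinOrder_iff_pow_eq_one.mpr ⟨6, by norm_num, kummerAut_pow_six κ hζ⟩
  exact this.finite_zpowers

/-- Averaging over the automorphism kills all powers of the root which are not in `F`, so the
invariants of the Kummer ring are `F`. -/
theorem isInvariant_kummerAut (κ : F) {ζ : F} (hζ : IsPrimitiveRoot ζ 6) (h6 : (6 : F) ≠ 0) :
    Algebra.IsInvariant F (KummerRing κ) (Subgroup.zpowers (kummerAut κ hζ.pow_eq_one)) where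
  isInvariant r hr := by
    let σ := kummerAut κ hζ.pow_eq_one
    have hσ : ∀ n : ℕ, (σ ^ n) r = r := fun n =>
      hr ⟨σ ^ n, Subgroup.pow_mem _ (Subgroup.mem_zpowers σ) n⟩
    have key (s : KummerRing κ) : ∃ c : F, algebraMap F _ c = ∑ n ∈ Finset.range 6, (σ ^ n) s := by
      obtain ⟨P, rfl⟩ := AdjoinRoot.mk_surjective s
      induction P using Polynomial.induction_on' with
      | add p q hp hq =>
        obtain ⟨a, ha⟩ := hp
        obtain ⟨b, hb⟩ := hq
        exact ⟨a + b, by simp only [map_add, ha, hb, Finset.sum_add_distrib]⟩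
      | monomial m c =>
        have hm : AdjoinRoot.mk (Polynomial.X ^ 6 - Polynomial.C κ) (Polynomial.monomial m c) =
            algebraMap F (KummerRing κ) c * kummerRoot κ ^ m := by
          rw [← Polynomial.C_mul_X_pow_eq_monomial, map_mul, map_pow, AdjoinRoot.mk_X]
          rfl
        have hsum : ∑ n ∈ Finset.range 6, (σ ^ n) (AdjoinRoot.mk _ (Polynomial.monomial m c)) =
            algebraMap F _ (∑ n ∈ Finset.range 6, (ζ ^ m) ^ n) *
              (algebraMap F _ c * kummerRoot κ ^ m) := by
          rw [map_sum, Finset.sum_mul]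
          refine Finset.sum_congr rfl fun n _ => ?_
          rw [hm, map_mul, map_pow, AlgEquiv.commutes, kummerAut_pow_root, mul_pow, ← map_pow,
            ← pow_mul, ← pow_mul, mul_comm n m, mul_left_comm]
        rw [hsum]
        by_cases hd : 6 ∣ m
        · obtain ⟨l, rfl⟩ := hd
          refine ⟨(∑ n ∈ Finset.range 6, (ζ ^ (6 * l)) ^ n) * (c * κ ^ l), ?_⟩
          rw [pow_mul (kummerRoot κ), kummerRoot_pow]
          simp only [map_mul, map_pow]
        · have h1 : ζ ^ m ≠ 1 := fun h => hd ((hζ.pow_eq_one_iff_dvd m).mp h)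
          have h0 : ∑ n ∈ Finset.range 6, (ζ ^ m) ^ n = 0 := by
            have := geom_sum_mul (ζ ^ m) 6
            rw [← pow_mul, mul_comm m 6, pow_mul, hζ.pow_eq_one, one_pow, sub_self] at this
            exact (mul_eq_zero.mp this).resolve_right (sub_ne_zero.mpr h1)
          exact ⟨0, by rw [h0, map_zero, zero_mul]⟩
    obtain ⟨c, hc⟩ := key r
    refine ⟨6⁻¹ * c, ?_⟩
    simp only [hσ, Finset.sum_const, Finset.card_range, nsmul_eq_mul] at hc
    have h6' : algebraMap F (KummerRing κ) 6 = ((6 : ℕ) : KummerRing κ) := by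
      rw [map_ofNat]; rfl
    rw [map_mul, hc, ← mul_assoc, ← h6', ← map_mul, inv_mul_cancel₀ h6, map_one, one_mul]

end Kummer

section Descent

/-- A morphism from `Spec R` which is invariant under a finite cyclic group with invariants the
field `F` descends to `Spec F`: the group permutes the points of `Spec R` transitively, so the
morphism lands in an affine open, whose functions pull back to invariants. -/
theorem exists_desc_of_isInvariant {F R : Type u} [Field F] [CommRing R] [Nontrivial R]
    [Algebra F R] (σ : R ≃ₐ[F] R) [Finite (Subgroup.zpowers σ)]
    [Algebra.IsInvariant F R (Subgroup.zpowers σ)] {Y : Scheme.{u}} (q : Spec (.of R) ⟶ Y)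
    (hq : Spec.map (CommRingCat.ofHom (σ : R →+* R)) ≫ q = q) :
    ∃ q₀ : Spec (.of F) ⟶ Y, Spec.map (CommRingCat.ofHom (algebraMap F R)) ≫ q₀ = q := by
  have hpow (n : ℕ) (z : Spec (.of R)) :
      q (Spec.map (CommRingCat.ofHom ((σ ^ n : R ≃ₐ[F] R) : R →+* R)) z) = q z := by
    induction n generalizing z with
    | zero => rfl
    | succ n ih =>
      have h : CommRingCat.ofHom ((σ ^ (n + 1) : R ≃ₐ[F] R) : R →+* R) =
          CommRingCat.ofHom (σ : R →+* R) ≫ CommRingCat.ofHom ((σ ^ n : R ≃ₐ[F] R) : R →+* R) := by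
        rw [pow_succ]; rfl
      rw [h, Spec.map_comp, Scheme.Hom.comp_apply, ← Scheme.Hom.comp_apply _ q, hq, ih]
  have hconst (z w : Spec (.of R)) : q z = q w := by
    have hzp : z.asIdeal.IsPrime := PrimeSpectrum.isPrime z
    have hwp : w.asIdeal.IsPrime := PrimeSpectrum.isPrime w
    have hz : z.asIdeal.under F = w.asIdeal.under F := by
      rw [(Ideal.eq_bot_or_top _).resolve_right (hzp.under F).ne_top,
        (Ideal.eq_bot_or_top _).resolve_right (hwp.under F).ne_top]
    obtain ⟨⟨g, hg⟩, hgw⟩ := Algebra.IsInvariant.exists_smul_of_under_eq F R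
      (Subgroup.zpowers σ) z.asIdeal w.asIdeal hz
    obtain ⟨n, rfl⟩ : g ∈ Submonoid.powers σ := by
      have : IsOfFinOrder σ := finite_zpowers.mp (Set.toFinite _)
      exact this.mem_powers_iff_mem_zpowers.mpr hg
    rw [← hpow n w]
    congr 1
    refine PrimeSpectrum.ext (Ideal.ext fun r => ?_)
    change r ∈ z.asIdeal ↔ (σ ^ n) r ∈ w.asIdeal
    rw [hgw]
    exact (Ideal.smul_mem_pointwise_smul_iff (a := (⟨σ ^ n, hg⟩ : Subgroup.zpowers σ))).symm
  obtain ⟨z₀⟩ : Nonempty (Spec (.of R)) := inferInstanceAs (Nonempty (PrimeSpectrum R))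
  obtain ⟨_, ⟨W, hW, rfl⟩, hzW, -⟩ :=
    Y.isBasis_affineOpens.exists_subset_of_mem_open (Set.mem_univ (q z₀)) isOpen_univ
  have := hW.isOpenImmersion_fromSpec
  have hrange : Set.range q ⊆ Set.range hW.fromSpec := by
    rintro _ ⟨z, rfl⟩
    rw [hW.range_fromSpec, hconst z z₀]
    exact hzW
  let l := IsOpenImmersion.lift hW.fromSpec q hrange
  obtain ⟨φ, hφ⟩ := Spec.map_surjective l
  have hlq : Spec.map φ ≫ hW.fromSpec = q := by
    rw [hφ]; exact IsOpenImmersion.lift_fac _ _ _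
  have hσφ : φ ≫ CommRingCat.ofHom (σ : R →+* R) = φ := by
    apply Spec.map_injective
    rw [← cancel_mono hW.fromSpec, Spec.map_comp, Category.assoc, hlq, hq]
  have hinv (s : Γ(Y, W)) : ∃ c : F, algebraMap F R c = φ s := by
    refine Algebra.IsInvariant.isInvariant (G := Subgroup.zpowers σ) _ fun g => ?_
    have h1 : σ ∈ MulAction.stabilizer (R ≃ₐ[F] R) (φ s) :=
      congrArg (fun f : Γ(Y, W) ⟶ .of R => f.hom s) hσφ
    exact Subgroup.zpowers_le.mpr h1 g.2
  let e : F ≃+* (algebraMap F R).range := RingEquiv.ofBijective (algebraMap F R).rangeRestrict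
    ⟨fun a b hab => (algebraMap F R).injective (congrArg Subtype.val hab),
      (algebraMap F R).rangeRestrict_surjective⟩
  let φ₀ : Γ(Y, W) →+* F :=
    (e.symm : (algebraMap F R).range →+* F).comp (φ.hom.codRestrict (algebraMap F R).range hinv)
  refine ⟨Spec.map (CommRingCat.ofHom φ₀) ≫ hW.fromSpec, ?_⟩
  rw [← Category.assoc, ← Spec.map_comp, ← hlq]
  congr 2
  ext s
  exact congrArg Subtype.val (e.apply_symm_apply ⟨φ s, hinv s⟩)

end Descent

/-! ### Charts of `Proj` -/

section Charts

open HomogeneousLocalization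

variable {k A : Type u} [CommRing k] [CommRing A] [Algebra k A]
  (𝒜 : ℕ → Submodule k A) [GradedAlgebra 𝒜]

/-- The homogeneous localization of a graded `k`-algebra is a `k`-algebra through the degree zero
part. -/
noncomputable instance awayAlgebra (f : A) : Algebra k (Away 𝒜 f) :=
  ((fromZeroRingHom 𝒜 (Submonoid.powers f)).comp (algebraMap k (𝒜 0))).toAlgebra

lemma awayι_projStr {m : ℕ} (f : A) (hf : f ∈ 𝒜 m) (hm : 0 < m) :
    Proj.awayι 𝒜 f hf hm ≫ projStr 𝒜 =
      Spec.map (CommRingCat.ofHom (algebraMap k (Away 𝒜 f))) := by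
  rw [projStr, Proj.awayι_toSpecZero_assoc, ← Spec.map_comp]
  rfl

lemma algebraMap_away_eq_mk {m : ℕ} (f : A) (hf : f ∈ 𝒜 m) (c : k) :
    algebraMap k (Away 𝒜 f) c = Away.mk 𝒜 hf 0 (algebraMap k A c)
      (by rw [zero_smul]; exact (algebraMap k (𝒜 0) c).2) := by
  rw [ext_iff_val, Away.val_mk]
  refine (val_mk _).trans ?_
  congr 1
  exact Subtype.ext (pow_zero f).symm

/-- A basic open subset of `Proj` defined by a homogeneous element of positive degree is empty only
if the element is nilpotent. -/
lemma isNilpotent_of_basicOpen_eq_bot {m : ℕ} {f : A} (hf : f ∈ 𝒜 m) (hm : 0 < m)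
    (h : Proj.basicOpen 𝒜 f = ⊥) : IsNilpotent f := by
  have hempty : IsEmpty (Spec (.of (Away 𝒜 f))) := by
    refine ⟨fun x => ?_⟩
    have hx : Proj.awayι 𝒜 f hf hm x ∈ (Proj.awayι 𝒜 f hf hm).opensRange := ⟨x, rfl⟩
    rw [Proj.opensRange_awayι, h] at hx
    exact hx
  have hsub : Subsingleton (Away 𝒜 f) := PrimeSpectrum.isEmpty_iff_subsingleton.mp hempty
  have h1 : (1 : Away 𝒜 f).val = (0 : Away 𝒜 f).val := by rw [Subsingleton.elim (1 : Away 𝒜 f) 0]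
  rw [val_one, val_zero] at h1
  have h0 : algebraMap A (Localization (Submonoid.powers f)) 1 = 0 := by rw [map_one, h1]
  obtain ⟨⟨_, n, rfl⟩, hn⟩ := (IsLocalization.map_eq_zero_iff (Submonoid.powers f) _ _).mp h0
  exact ⟨n, by simpa using hn⟩

/-- The chart of `Proj` given by a homogeneous nonzerodivisor of positive degree is dense. -/
lemma isDominant_awayι {m : ℕ} {f : A} (hf : f ∈ 𝒜 m) (hm : 0 < m) (hreg : f ∈ nonZeroDivisors A) :
    IsDominant (Proj.awayι 𝒜 f hf hm) := by
  refine ⟨?_⟩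
  rw [DenseRange, ← Scheme.Hom.coe_opensRange, Proj.opensRange_awayι, dense_iff_inter_open]
  rintro U hU ⟨x, hx⟩
  obtain ⟨_, ⟨_, ⟨g, rfl⟩, rfl⟩, hxg, hgU⟩ :=
    (Proj.isBasis_basicOpen 𝒜).exists_subset_of_mem_open hx hU
  change x ∈ Proj.basicOpen 𝒜 g at hxg
  have hgU' := hgU
  rw [Proj.basicOpen_eq_iSup_proj] at hxg
  obtain ⟨i, hi⟩ := TopologicalSpace.Opens.mem_iSup.mp hxg
  set g' : A := GradedRing.proj 𝒜 i g with hg'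
  have hg'mem : g' ∈ 𝒜 i := SetLike.coe_mem _
  by_contra hne
  have hbot : Proj.basicOpen 𝒜 (g' * f) = ⊥ := by
    rw [Proj.basicOpen_mul]
    refine eq_bot_iff.mpr fun y hy => hne ⟨y, hgU ?_, hy.2⟩
    change y ∈ Proj.basicOpen 𝒜 g
    rw [Proj.basicOpen_eq_iSup_proj]
    exact TopologicalSpace.Opens.mem_iSup.mpr ⟨i, hy.1⟩
  obtain ⟨n, hn⟩ := isNilpotent_of_basicOpen_eq_bot 𝒜 (SetLike.mul_mem_graded hg'mem hf)
    (by omega) hbot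
  rw [mul_pow] at hn
  have hn' : g' ^ n = 0 := (mul_right_mem_nonZeroDivisors_eq_zero_iff (pow_mem hreg n)).mp hn
  have hxg' : g' ∉ x.asHomogeneousIdeal := hi
  have : g' ^ n ∈ x.asHomogeneousIdeal := by rw [hn']; exact Submodule.zero_mem _
  exact hxg' (x.isPrime.mem_of_pow_mem n this)

/-- A homomorphism from a graded algebra that sends `f` to `1` extends to the ring of functions on
the chart `D₊(f)`. -/
noncomputable def awayEvalHom {S : Type u} [CommRing S] [Algebra k S] {f : A} (e : A →ₐ[k] S)
    (he : e f = 1) : Away 𝒜 f →+* S :=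
  (Localization.awayLift e.toRingHom f
    (isUnit_iff_exists_inv.mpr ⟨1, (mul_one _).trans he⟩)).comp
    (algebraMap (Away 𝒜 f) (Localization.Away f))

lemma awayEvalHom_mk {S : Type u} [CommRing S] [Algebra k S] {m : ℕ} {f : A} (hf : f ∈ 𝒜 m)
    (e : A →ₐ[k] S) (he : e f = 1) (n : ℕ) (a : A) (ha : a ∈ 𝒜 (n • m)) :
    awayEvalHom 𝒜 e he (Away.mk 𝒜 hf n a ha) = e a := by
  rw [awayEvalHom, RingHom.comp_apply, HomogeneousLocalization.algebraMap_apply, Away.val_mk,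
    Localization.awayLift_mk (hv := (mul_one _).trans he), one_pow, mul_one]
  rfl

/-- The `k`-algebra homomorphism underlying `awayEvalHom`. -/
noncomputable def awayEval {S : Type u} [CommRing S] [Algebra k S] {m : ℕ} {f : A} (hf : f ∈ 𝒜 m)
    (e : A →ₐ[k] S) (he : e f = 1) : Away 𝒜 f →ₐ[k] S where
  __ := awayEvalHom 𝒜 e he
  commutes' c := by
    rw [algebraMap_away_eq_mk _ _ hf]
    exact (awayEvalHom_mk 𝒜 hf e he _ _ _).trans (e.commutes c)

lemma awayEval_mk {S : Type u} [CommRing S] [Algebra k S] {m : ℕ} {f : A} (hf : f ∈ 𝒜 m)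
    (e : A →ₐ[k] S) (he : e f = 1) (n : ℕ) (a : A) (ha : a ∈ 𝒜 (n • m)) :
    awayEval 𝒜 hf e he (Away.mk 𝒜 hf n a ha) = e a :=
  awayEvalHom_mk 𝒜 hf e he n a ha

variable {𝒜}

/-- A graded endomorphism fixing `f` acts on the chart `D₊(f)` by acting on numerators. -/
lemma exists_awayι_comp_map (φ : 𝒜 →+*ᵍ 𝒜) (hφ : HomogeneousIdeal.irrelevant 𝒜 ≤
    (HomogeneousIdeal.irrelevant 𝒜).map φ) {m : ℕ} {f : A} (hf : f ∈ 𝒜 m) (hm : 0 < m)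
    (hφf : φ f = f) :
    ∃ τ : Away 𝒜 f →+* Away 𝒜 f,
      Proj.awayι 𝒜 f hf hm ≫ Proj.map φ hφ =
        Spec.map (CommRingCat.ofHom τ) ≫ Proj.awayι 𝒜 f hf hm ∧
      ∀ (n : ℕ) (a : A) (ha : a ∈ 𝒜 (n • m)),
        τ (Away.mk 𝒜 hf n a ha) = Away.mk 𝒜 hf n (φ a) (φ.map_mem ha) := by
  have key : ∀ (f' : A) (hf' : f' ∈ 𝒜 m), φ f = f' → ∃ τ : Away 𝒜 f →+* Away 𝒜 f',
      Proj.awayι 𝒜 f' hf' hm ≫ Proj.map φ hφ =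
        Spec.map (CommRingCat.ofHom τ) ≫ Proj.awayι 𝒜 f hf hm ∧
      ∀ (n : ℕ) (a : A) (ha : a ∈ 𝒜 (n • m)),
        τ (Away.mk 𝒜 hf n a ha) = Away.mk 𝒜 hf' n (φ a) (φ.map_mem ha) := by
    rintro _ hf' rfl
    exact ⟨Away.map φ f, Proj.awayι_comp_map φ hφ hm f hf,
      fun n a ha => Away.map_mk φ f hf n a ha⟩
  exact key f hf hφf

end Charts

/-! ### Open charts of products over a field -/

section ProductCharts

variable {k : Type u} [Field k]

open scoped TensorProduct

/-- Dense affine charts of two schemes over a field give a dense affine chart of the product. -/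
lemma exists_chart_pullback {E : Scheme.{u}} (s : E ⟶ Spec (.of k)) (B : Type u) [CommRing B]
    [Algebra k B] (j : Spec (.of B) ⟶ E) [IsOpenImmersion j] [IsDominant j]
    (hj : j ≫ s = Spec.map (CommRingCat.ofHom (algebraMap k B))) :
    ∃ J : Spec (.of (B ⊗[k] B)) ⟶ pullback s s, IsOpenImmersion J ∧ IsDominant J ∧
      J ≫ pullback.fst s s =
        Spec.map (CommRingCat.ofHom (Algebra.TensorProduct.includeLeftRingHom)) ≫ j ∧
      J ≫ pullback.snd s s =
        Spec.map (CommRingCat.ofHom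
          (Algebra.TensorProduct.includeRight : B →ₐ[k] B ⊗[k] B).toRingHom) ≫ j := by
  let p := pullback.map (Spec.map (CommRingCat.ofHom (algebraMap k B)))
    (Spec.map (CommRingCat.ofHom (algebraMap k B))) s s j j (𝟙 _) (by simp [hj]) (by simp [hj])
  have hp : IsOpenImmersion p := inferInstance
  have hpd : IsDominant p := by
    refine ⟨?_⟩
    rw [DenseRange, Scheme.Pullback.range_map]
    have hsub : Subsingleton (Spec (.of k)) := inferInstanceAs (Subsingleton (PrimeSpectrum k))
    have hs : UniversallyOpen s := inferInstance
    have h1 := j.denseRange.preimage (pullback.fst s s).isOpenMap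
    have h2 := j.denseRange.preimage (pullback.snd s s).isOpenMap
    exact h1.inter_of_isOpen_left h2
      (j.isOpenEmbedding.isOpen_range.preimage (pullback.fst s s).continuous)
  refine ⟨(pullbackSpecIso k B B).inv ≫ p, inferInstance, inferInstance, ?_, ?_⟩
  · rw [Category.assoc, pullback.lift_fst, pullbackSpecIso_inv_fst_assoc]
  · rw [Category.assoc, pullback.lift_snd, pullbackSpecIso_inv_snd_assoc]
    rfl

end ProductCharts

/-! ### The affine chart and the points of the curve -/

lemma eval₂_mul_of_isHomogeneous {R S σ : Type*} [CommSemiring R] [CommSemiring S] [Fintype σ]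
    (f : R →+* S) (z : S) (w : σ → S) {p : MvPolynomial σ R} {n : ℕ} (hp : p.IsHomogeneous n) :
    eval₂ f (fun i => z * w i) p = z ^ n * eval₂ f w p := by
  rw [eval₂_eq', eval₂_eq', Finset.mul_sum]
  refine Finset.sum_congr rfl fun d hd => ?_
  have hdeg : ∑ i, d i = n := by
    rw [← hp (mem_support_iff.mp hd), ← Finsupp.degree_eq_sum, Finsupp.degree_eq_weight_one]
    rfl
  simp only [mul_pow, Finset.prod_mul_distrib, Finset.prod_pow_eq_pow_sum, hdeg]
  ring

section AffinePoints

open HomogeneousLocalization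

variable (k : Type u) [Field k]

attribute [local instance] MvPolynomial.gradedAlgebra

/-- The coordinate `x`, `y` or `z` in the homogeneous coordinate ring of `E(6)`. -/
noncomputable def coord (i : Fin 3) : E6Ring k := Ideal.Quotient.mk (E6Ideal k) (X i)

lemma coord_mem (i : Fin 3) : coord k i ∈ E6Grading k 1 :=
  ⟨X i, (mem_homogeneousSubmodule 1 _).mpr (isHomogeneous_X k i), rfl⟩

lemma coord_mem_one_smul (i : Fin 3) : coord k i ∈ E6Grading k (1 • 1) := coord_mem k i

lemma coord_equation : coord k 1 ^ 2 * coord k 2 = coord k 0 ^ 3 - coord k 2 ^ 3 := by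
  have h : Ideal.Quotient.mk (E6Ideal k) (cubic k) = 0 :=
    Ideal.Quotient.eq_zero_iff_mem.mpr (Ideal.subset_span rfl)
  rw [cubic, map_sub, sub_eq_zero] at h
  simpa [coord] using h

/-- The coordinate ring of the affine curve `E(6) ∖ {z = 0}`, that is, of `y² = x³ - 1`. -/
abbrev AffRing : Type u := Away (E6Grading k) (coord k 2)

/-- The functions `x / z`, `y / z` and `z / z = 1` on the affine part of `E(6)`. -/
noncomputable def affCoord (i : Fin 3) : AffRing k :=
  Away.mk (E6Grading k) (coord_mem k 2) 1 (coord k i) (coord_mem_one_smul k i)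

lemma coord_mul_val_affCoord (i : Fin 3) :
    algebraMap (E6Ring k) (Localization.Away (coord k 2)) (coord k 2) * (affCoord k i).val =
      algebraMap (E6Ring k) (Localization.Away (coord k 2)) (coord k i) := by
  rw [affCoord, Away.val_mk, Localization.mk_eq_mk', mul_comm]
  simpa only [pow_one] using IsLocalization.mk'_spec (Localization.Away (coord k 2)) (coord k i)
    (⟨coord k 2 ^ 1, 1, rfl⟩ : Submonoid.powers (coord k 2))

lemma affCoord_two : affCoord k 2 = 1 := by
  rw [ext_iff_val, val_one, affCoord, Away.val_mk, Localization.mk_eq_mk']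
  symm
  rw [IsLocalization.eq_mk'_iff_mul_eq]
  simp

lemma isUnit_coord_two :
    IsUnit (algebraMap (E6Ring k) (Localization.Away (coord k 2)) (coord k 2)) :=
  IsLocalization.Away.algebraMap_isUnit _

lemma affCoord_equation : affCoord k 1 ^ 2 = affCoord k 0 ^ 3 - 1 := by
  rw [ext_iff_val, val_sub, val_pow, val_pow, val_one]
  have h := congrArg (algebraMap (E6Ring k) (Localization.Away (coord k 2))) (coord_equation k)
  simp only [map_mul, map_pow, map_sub, ← coord_mul_val_affCoord k 0,
    ← coord_mul_val_affCoord k 1] at h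
  refine ((isUnit_coord_two k).pow 3).mul_left_cancel ?_
  linear_combination h

/-- The affine coordinate ring of `E(6)` is generated by `x / z` and `y / z`. -/
lemma adjoin_affCoord : Algebra.adjoin k {affCoord k 0, affCoord k 1} = ⊤ := by
  rw [eq_top_iff]
  rintro b -
  obtain ⟨n, a, ha, rfl⟩ := Away.mk_surjective (E6Grading k) (coord_mem k 2) b
  obtain ⟨p, hp, hpa⟩ := id ha
  replace hpa : Ideal.Quotient.mk (E6Ideal k) p = a := hpa
  subst hpa
  have hp' : p.IsHomogeneous n := by simpa using hp
  have key : Away.mk (E6Grading k) (coord_mem k 2) n (Ideal.Quotient.mk (E6Ideal k) p) ha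
      = aeval (affCoord k) p := by
    rw [ext_iff_val, Away.val_mk, Localization.mk_eq_mk', IsLocalization.mk'_eq_iff_eq_mul]
    let L := Localization.Away (coord k 2)
    let c : k →+* L := (algebraMap (AffRing k) L).comp (algebraMap k (AffRing k))
    have h1 : algebraMap (E6Ring k) L (Ideal.Quotient.mk (E6Ideal k) p) =
        eval₂ c (fun i => algebraMap (E6Ring k) L (coord k i)) p := by
      have : ((algebraMap (E6Ring k) L).comp (Ideal.Quotient.mk (E6Ideal k))) =
          eval₂Hom c (fun i => algebraMap (E6Ring k) L (coord k i)) := by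
        refine MvPolynomial.ringHom_ext (fun r => ?_) fun i => ?_
        · simp only [coe_eval₂Hom, eval₂_C, c, RingHom.comp_apply]
          rw [algebraMap_away_eq_mk _ _ (coord_mem k 2),
            HomogeneousLocalization.algebraMap_apply, Away.val_mk, Localization.mk_eq_mk']
          symm
          rw [IsLocalization.mk'_eq_iff_eq_mul]
          simp only [pow_zero, map_one, mul_one]
          rfl
        · simp [coord]
      exact DFunLike.congr_fun this p
    have h2 : (aeval (affCoord k) p).val = eval₂ c (fun i => (affCoord k i).val) p :=
      (eval₂_comp_left (algebraMap (AffRing k) L) (algebraMap k (AffRing k)) (affCoord k) p)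
    have h3 : (fun i => algebraMap (E6Ring k) L (coord k i)) =
        fun i => algebraMap (E6Ring k) L (coord k 2) * (affCoord k i).val :=
      funext fun i => (coord_mul_val_affCoord k i).symm
    rw [h1, h2, h3, eval₂_mul_of_isHomogeneous c _ _ hp', mul_comm, ← map_pow]
  rw [key]
  refine Algebra.adjoin_le (S := Algebra.adjoin k {affCoord k 0, affCoord k 1}) ?_
    ((Algebra.adjoin_range_eq_range_aeval k (affCoord k)).ge ⟨p, rfl⟩)
  rintro _ ⟨i, rfl⟩
  fin_cases i
  · exact Algebra.subset_adjoin (Set.mem_insert _ _)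
  · exact Algebra.subset_adjoin (Set.mem_insert_of_mem _ rfl)
  · exact (affCoord_two k).symm ▸ one_mem _

/-- The coordinate `z` does not divide the cubic, so it is regular on `E(6)`. -/
lemma coord_two_mem_nonZeroDivisors : coord k 2 ∈ nonZeroDivisors (E6Ring k) := by
  rw [mem_nonZeroDivisors_iff_left]
  intro a ha
  obtain ⟨p, rfl⟩ := Ideal.Quotient.mk_surjective a
  rw [coord, ← map_mul, Ideal.Quotient.eq_zero_iff_mem, Ideal.mem_span_singleton] at ha
  rw [Ideal.Quotient.eq_zero_iff_mem, Ideal.mem_span_singleton]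
  obtain ⟨q, hq⟩ := ha
  have hprime : Prime (X 2 : MvPolynomial (Fin 3) k) := X_prime
  have hnot : ¬ (X 2 : MvPolynomial (Fin 3) k) ∣ cubic k := by
    rintro ⟨r, hr⟩
    have := congrArg (eval ![1, 0, 0]) hr
    simp [cubic] at this
  obtain ⟨r, rfl⟩ := (hprime.dvd_or_dvd (Dvd.intro _ hq)).resolve_left hnot
  refine ⟨r, mul_left_cancel₀ hprime.ne_zero ?_⟩
  rw [hq]
  ring

/-- The chart `{z ≠ 0}` of `E(6)`. -/
noncomputable def affChart : Spec (.of (AffRing k)) ⟶ E6 k :=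
  Proj.awayι (E6Grading k) (coord k 2) (coord_mem k 2) one_pos

instance : IsOpenImmersion (affChart k) :=
  inferInstanceAs (IsOpenImmersion (Proj.awayι (E6Grading k) (coord k 2) (coord_mem k 2) one_pos))

instance : IsDominant (affChart k) :=
  isDominant_awayι (E6Grading k) (coord_mem k 2) one_pos (coord_two_mem_nonZeroDivisors k)

lemma affChart_str :
    affChart k ≫ E6Str k = Spec.map (CommRingCat.ofHom (algebraMap k (AffRing k))) :=
  awayι_projStr (E6Grading k) (coord k 2) (coord_mem k 2) one_pos

variable {k} {S : Type u} [CommRing S] [Algebra k S]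

/-- Evaluation of homogeneous coordinates at the affine point `(x : y : 1)` of `E(6)`. -/
noncomputable def evalCoord (x y : S) (h : y ^ 2 = x ^ 3 - 1) : E6Ring k →ₐ[k] S :=
  Ideal.Quotient.liftₐ (E6Ideal k) (aeval ![x, y, 1]) fun a ha => by
    obtain ⟨q, rfl⟩ := Ideal.mem_span_singleton.mp ha
    simp [cubic, h]

lemma evalCoord_coord (x y : S) (h : y ^ 2 = x ^ 3 - 1) (i : Fin 3) :
    evalCoord (k := k) x y h (coord k i) = ![x, y, 1] i := by
  exact aeval_X _ _

lemma evalCoord_coord_two (x y : S) (h : y ^ 2 = x ^ 3 - 1) :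
    evalCoord (k := k) x y h (coord k 2) = 1 := evalCoord_coord x y h 2

/-- Evaluation of functions on the affine curve `y² = x³ - 1` at a point. -/
noncomputable def evalAff (x y : S) (h : y ^ 2 = x ^ 3 - 1) : AffRing k →ₐ[k] S :=
  awayEval (E6Grading k) (coord_mem k 2) (evalCoord x y h) (evalCoord_coord_two x y h)

lemma evalAff_mk (x y : S) (h : y ^ 2 = x ^ 3 - 1) (n : ℕ) (a : E6Ring k)
    (ha : a ∈ E6Grading k (n • 1)) :
    evalAff (k := k) x y h (Away.mk (E6Grading k) (coord_mem k 2) n a ha) = evalCoord x y h a :=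
  awayEval_mk (E6Grading k) (coord_mem k 2) _ _ n a ha

lemma evalAff_affCoord (x y : S) (h : y ^ 2 = x ^ 3 - 1) (i : Fin 3) :
    evalAff (k := k) x y h (affCoord k i) = ![x, y, 1] i := by
  rw [affCoord, evalAff_mk, evalCoord_coord]

lemma evalAff_naturality {S' : Type u} [CommRing S'] [Algebra k S'] (φ : S →ₐ[k] S') {x y : S}
    (h : y ^ 2 = x ^ 3 - 1) (h' : φ y ^ 2 = φ x ^ 3 - 1) :
    φ.comp (evalAff x y h) = evalAff (φ x) (φ y) h' := by
  refine AlgHom.ext_of_adjoin_eq_top (adjoin_affCoord k) ?_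
  rintro _ (rfl | rfl) <;> simp [evalAff_affCoord]

/-- The point `(x : y : 1)` of `E(6)` with coordinates in a `k`-algebra. -/
noncomputable def affPoint (x y : S) (h : y ^ 2 = x ^ 3 - 1) : Spec (.of S) ⟶ E6 k :=
  Spec.map (CommRingCat.ofHom (evalAff (k := k) x y h).toRingHom) ≫ affChart k

lemma affPoint_str (x y : S) (h : y ^ 2 = x ^ 3 - 1) :
    affPoint x y h ≫ E6Str k = Spec.map (CommRingCat.ofHom (algebraMap k S)) := by
  rw [affPoint, Category.assoc, affChart_str, ← Spec.map_comp, ← CommRingCat.ofHom_comp]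
  congr 2
  exact (evalAff (k := k) x y h).comp_algebraMap

lemma affPoint_naturality {S' : Type u} [CommRing S'] [Algebra k S'] (φ : S →ₐ[k] S') {x y : S}
    (h : y ^ 2 = x ^ 3 - 1) (h' : φ y ^ 2 = φ x ^ 3 - 1) :
    Spec.map (CommRingCat.ofHom φ.toRingHom) ≫ affPoint (k := k) x y h =
      affPoint (φ x) (φ y) h' := by
  rw [affPoint, affPoint, ← Spec.map_comp_assoc, ← CommRingCat.ofHom_comp,
    ← evalAff_naturality φ h h']
  rfl

variable {ω : k} (hω : IsPrimitiveRoot ω 3)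

lemma g6Ring_coord (i : Fin 3) :
    g6Ring hω (coord k i) = Ideal.Quotient.mk (E6Ideal k) (g6Poly ω (X i)) := rfl

lemma g6_equation {ω : k} (hω : IsPrimitiveRoot ω 3) {x y : S} (h : y ^ 2 = x ^ 3 - 1) :
    (-y) ^ 2 = (algebraMap k S ω * x) ^ 3 - 1 := by
  rw [mul_pow, ← map_pow, hω.pow_eq_one, map_one, one_mul, neg_sq, h]

lemma evalCoord_g6Ring {x y : S} (h : y ^ 2 = x ^ 3 - 1) (a : E6Ring k) :
    evalCoord x y h (g6Ring hω a) =
      evalCoord (algebraMap k S ω * x) (-y) (g6_equation hω h) a := by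
  obtain ⟨p, rfl⟩ := Ideal.Quotient.mk_surjective a
  change aeval ![x, y, 1] (g6Poly ω p) = aeval ![algebraMap k S ω * x, -y, 1] p
  rw [← AlgHom.comp_apply]
  congr 1
  refine MvPolynomial.algHom_ext fun i => ?_
  fin_cases i <;> simp [g6Poly]

lemma affPoint_g6 {x y : S} (h : y ^ 2 = x ^ 3 - 1) :
    affPoint x y h ≫ g6 hω = affPoint (algebraMap k S ω * x) (-y) (g6_equation hω h) := by
  have hz : g6Ring hω (coord k 2) = coord k 2 := by
    rw [g6Ring_coord]
    simp [g6Poly, coord]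
  obtain ⟨τ, h1, h2⟩ := exists_awayι_comp_map (g6Ring hω)
    (irrelevant_le_map (E6Grading k) (g6Ring hω) (g6Ring_iterate hω)) (coord_mem k 2) one_pos hz
  have h1' : affChart k ≫ g6 hω = Spec.map (CommRingCat.ofHom τ) ≫ affChart k := h1
  rw [affPoint, affPoint, Category.assoc, h1', ← Spec.map_comp_assoc, ← CommRingCat.ofHom_comp]
  congr 3
  refine RingHom.ext fun b => ?_
  obtain ⟨n, a, ha, rfl⟩ := Away.mk_surjective (E6Grading k) (coord_mem k 2) b
  change evalAff (k := k) x y h (τ _) = evalAff (k := k) _ _ _ _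
  rw [h2, evalAff_mk, evalAff_mk, evalCoord_g6Ring]

end AffinePoints

/-! ### Points of the fourfold -/

section FourPoints

open scoped TensorProduct

variable {k : Type u} [Field k] {S : Type u} [CommRing S] [Algebra k S]

lemma forall_fin_four {P : Fin 4 → Prop} : (∀ i, P i) ↔ P 0 ∧ P 1 ∧ P 2 ∧ P 3 := by
  simp [Fin.forall_fin_succ]

/-- The point of `E(6)²` given by two affine points of `E(6)`. -/
noncomputable def sqPoint (x₀ y₀ x₁ y₁ : S) (h₀ : y₀ ^ 2 = x₀ ^ 3 - 1) (h₁ : y₁ ^ 2 = x₁ ^ 3 - 1) :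
    Spec (.of S) ⟶ pullback (E6Str k) (E6Str k) :=
  pullback.lift (affPoint x₀ y₀ h₀) (affPoint x₁ y₁ h₁) (by rw [affPoint_str, affPoint_str])

lemma sqPoint_str (x₀ y₀ x₁ y₁ : S) (h₀ : y₀ ^ 2 = x₀ ^ 3 - 1) (h₁ : y₁ ^ 2 = x₁ ^ 3 - 1) :
    sqPoint x₀ y₀ x₁ y₁ h₀ h₁ ≫ E6SqStr k = Spec.map (CommRingCat.ofHom (algebraMap k S)) := by
  rw [sqPoint, E6SqStr, pullback.lift_fst_assoc, affPoint_str]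

/-- The point of `E(6)⁴` given by four affine points of `E(6)`. -/
noncomputable def fourPoint (x y : Fin 4 → S) (h : ∀ i, y i ^ 2 = x i ^ 3 - 1) :
    Spec (.of S) ⟶ Z46 k :=
  pullback.lift (sqPoint (x 0) (y 0) (x 1) (y 1) (h 0) (h 1))
    (sqPoint (x 2) (y 2) (x 3) (y 3) (h 2) (h 3)) (by rw [sqPoint_str, sqPoint_str])

lemma fourPoint_str (x y : Fin 4 → S) (h : ∀ i, y i ^ 2 = x i ^ 3 - 1) :
    fourPoint x y h ≫ Z46Str k = Spec.map (CommRingCat.ofHom (algebraMap k S)) := by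
  rw [fourPoint, Z46Str]
  exact (pullback.lift_fst_assoc _ _ _ _).trans (sqPoint_str _ _ _ _ _ _)

/-- The first projection `E(6)⁴ ⟶ E(6)²`. -/
noncomputable def sqFst (k : Type u) [Field k] : Z46 k ⟶ pullback (E6Str k) (E6Str k) :=
  pullback.fst (E6SqStr k) (E6SqStr k)

/-- The second projection `E(6)⁴ ⟶ E(6)²`. -/
noncomputable def sqSnd (k : Type u) [Field k] : Z46 k ⟶ pullback (E6Str k) (E6Str k) :=
  pullback.snd (E6SqStr k) (E6SqStr k)

lemma fourPoint_sqFst (x y : Fin 4 → S) (h : ∀ i, y i ^ 2 = x i ^ 3 - 1) :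
    fourPoint x y h ≫ sqFst k = sqPoint (x 0) (y 0) (x 1) (y 1) (h 0) (h 1) :=
  pullback.lift_fst _ _ _

lemma fourPoint_sqSnd (x y : Fin 4 → S) (h : ∀ i, y i ^ 2 = x i ^ 3 - 1) :
    fourPoint x y h ≫ sqSnd k = sqPoint (x 2) (y 2) (x 3) (y 3) (h 2) (h 3) :=
  pullback.lift_snd _ _ _

/-- The four projections `E(6)⁴ ⟶ E(6)`. -/
noncomputable def coordProj (k : Type u) [Field k] : Fin 4 → (Z46 k ⟶ E6 k) :=
  ![sqFst k ≫ pullback.fst _ _, sqFst k ≫ pullback.snd _ _,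
    sqSnd k ≫ pullback.fst _ _, sqSnd k ≫ pullback.snd _ _]

lemma coordProj_zero : coordProj k 0 = sqFst k ≫ pullback.fst _ _ := rfl

lemma coordProj_one : coordProj k 1 = sqFst k ≫ pullback.snd _ _ := rfl

lemma coordProj_two : coordProj k 2 = sqSnd k ≫ pullback.fst _ _ := rfl

lemma coordProj_three : coordProj k 3 = sqSnd k ≫ pullback.snd _ _ := rfl

lemma hom_ext_coordProj {T : Scheme.{u}} {a b : T ⟶ Z46 k}
    (h : ∀ i, a ≫ coordProj k i = b ≫ coordProj k i) : a = b := by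
  have h0 := h 0
  have h1 := h 1
  have h2 := h 2
  have h3 := h 3
  rw [coordProj_zero, ← Category.assoc, ← Category.assoc] at h0
  rw [coordProj_one, ← Category.assoc, ← Category.assoc] at h1
  rw [coordProj_two, ← Category.assoc, ← Category.assoc] at h2
  rw [coordProj_three, ← Category.assoc, ← Category.assoc] at h3
  exact pullback.hom_ext (pullback.hom_ext h0 h1) (pullback.hom_ext h2 h3)

lemma fourPoint_coordProj (x y : Fin 4 → S) (h : ∀ i, y i ^ 2 = x i ^ 3 - 1) (i : Fin 4) :
    fourPoint x y h ≫ coordProj k i = affPoint (x i) (y i) (h i) := by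
  revert i
  rw [forall_fin_four]
  refine ⟨?_, ?_, ?_, ?_⟩
  · rw [coordProj_zero, ← Category.assoc, fourPoint_sqFst]
    exact pullback.lift_fst _ _ _
  · rw [coordProj_one, ← Category.assoc, fourPoint_sqFst]
    exact pullback.lift_snd _ _ _
  · rw [coordProj_two, ← Category.assoc, fourPoint_sqSnd]
    exact pullback.lift_fst _ _ _
  · rw [coordProj_three, ← Category.assoc, fourPoint_sqSnd]
    exact pullback.lift_snd _ _ _

lemma fourPoint_naturality {S' : Type u} [CommRing S'] [Algebra k S'] (φ : S →ₐ[k] S')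
    {x y : Fin 4 → S} (h : ∀ i, y i ^ 2 = x i ^ 3 - 1) {x' y' : Fin 4 → S'}
    (h' : ∀ i, y' i ^ 2 = x' i ^ 3 - 1) (hx : ∀ i, φ (x i) = x' i) (hy : ∀ i, φ (y i) = y' i) :
    Spec.map (CommRingCat.ofHom φ.toRingHom) ≫ fourPoint (k := k) x y h = fourPoint x' y' h' := by
  obtain rfl : (fun i => φ (x i)) = x' := funext hx
  obtain rfl : (fun i => φ (y i)) = y' := funext hy
  refine hom_ext_coordProj fun i => ?_
  rw [Category.assoc, fourPoint_coordProj, fourPoint_coordProj]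
  exact affPoint_naturality φ _ (h' i)

variable {ω : k} (hω : IsPrimitiveRoot ω 3)

lemma diagonalSq_fst {T C : Scheme.{u}} (s : C ⟶ T) (g : C ⟶ C) (hg : g ≫ s = s) :
    diagonalSq s g hg ≫ pullback.fst s s = pullback.fst s s ≫ g :=
  pullback.lift_fst _ _ _

lemma diagonalSq_snd {T C : Scheme.{u}} (s : C ⟶ T) (g : C ⟶ C) (hg : g ≫ s = s) :
    diagonalSq s g hg ≫ pullback.snd s s = pullback.snd s s ≫ g :=
  pullback.lift_snd _ _ _

lemma g46_sqFst : g46 hω ≫ sqFst k = sqFst k ≫ diagonalSq (E6Str k) (g6 hω) (g6_str hω) :=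
  diagonalSq_fst _ _ _

lemma g46_sqSnd : g46 hω ≫ sqSnd k = sqSnd k ≫ diagonalSq (E6Str k) (g6 hω) (g6_str hω) :=
  diagonalSq_snd _ _ _

lemma g46_coordProj (i : Fin 4) : g46 hω ≫ coordProj k i = coordProj k i ≫ g6 hω := by
  revert i
  rw [forall_fin_four]
  refine ⟨?_, ?_, ?_, ?_⟩
  · rw [coordProj_zero, reassoc_of% g46_sqFst, diagonalSq_fst, Category.assoc]
  · rw [coordProj_one, reassoc_of% g46_sqFst, diagonalSq_snd, Category.assoc]
  · rw [coordProj_two, reassoc_of% g46_sqSnd, diagonalSq_fst, Category.assoc]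
  · rw [coordProj_three, reassoc_of% g46_sqSnd, diagonalSq_snd, Category.assoc]

/-- The diagonal automorphism acts on four affine points by `(x, y) ↦ (ω x, -y)`. -/
lemma fourPoint_g46 {x y : Fin 4 → S} (h : ∀ i, y i ^ 2 = x i ^ 3 - 1) :
    fourPoint x y h ≫ g46 hω = fourPoint (fun i => algebraMap k S ω * x i) (fun i => -y i)
      (fun i => g6_equation hω (h i)) := by
  refine hom_ext_coordProj fun i => ?_
  rw [Category.assoc, g46_coordProj, ← Category.assoc, fourPoint_coordProj, fourPoint_coordProj,
    affPoint_g6]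

/-- The affine coordinate ring of `E(6)⁴ ∖ {z₀ z₁ z₂ z₃ = 0}`. -/
abbrev FourRing (k : Type u) [Field k] : Type u :=
  (AffRing k ⊗[k] AffRing k) ⊗[k] (AffRing k ⊗[k] AffRing k)

/-- The four inclusions of the coordinate ring of the affine curve into that of its fourfold
product. -/
noncomputable def fourIncl (k : Type u) [Field k] : Fin 4 → (AffRing k →ₐ[k] FourRing k) :=
  ![Algebra.TensorProduct.includeLeft.comp Algebra.TensorProduct.includeLeft,
    Algebra.TensorProduct.includeLeft.comp Algebra.TensorProduct.includeRight,
    Algebra.TensorProduct.includeRight.comp Algebra.TensorProduct.includeLeft,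
    Algebra.TensorProduct.includeRight.comp Algebra.TensorProduct.includeRight]

lemma adjoin_fourIncl :
    Algebra.adjoin k (Set.range (fun i => fourIncl k i (affCoord k 0)) ∪
      Set.range (fun i => fourIncl k i (affCoord k 1))) = ⊤ := by
  set A := Algebra.adjoin k (Set.range (fun i => fourIncl k i (affCoord k 0)) ∪
      Set.range (fun i => fourIncl k i (affCoord k 1))) with hA
  have key : ∀ i b, fourIncl k i b ∈ A := by
    intro i b
    have hle : (⊤ : Subalgebra k (AffRing k)) ≤ A.comap (fourIncl k i) := by
      rw [← adjoin_affCoord, Algebra.adjoin_le_iff]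
      rintro _ (rfl | rfl)
      · exact Algebra.subset_adjoin (Or.inl ⟨i, rfl⟩)
      · exact Algebra.subset_adjoin (Or.inr ⟨i, rfl⟩)
    exact hle Algebra.mem_top
  have hl : ∀ t : AffRing k ⊗[k] AffRing k, t ⊗ₜ[k] (1 : AffRing k ⊗[k] AffRing k) ∈ A := by
    intro t
    induction t with
    | zero => rw [TensorProduct.zero_tmul]; exact zero_mem A
    | add a b ha hb => rw [TensorProduct.add_tmul]; exact add_mem ha hb
    | tmul a b =>
      have := mul_mem (key 0 a) (key 1 b)
      simpa [fourIncl] using this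
  have hr : ∀ t : AffRing k ⊗[k] AffRing k, (1 : AffRing k ⊗[k] AffRing k) ⊗ₜ[k] t ∈ A := by
    intro t
    induction t with
    | zero => rw [TensorProduct.tmul_zero]; exact zero_mem A
    | add a b ha hb => rw [TensorProduct.tmul_add]; exact add_mem ha hb
    | tmul a b =>
      have := mul_mem (key 2 a) (key 3 b)
      simpa [fourIncl] using this
  refine eq_top_iff.mpr fun t _ => ?_
  induction t using TensorProduct.induction_on with
  | zero => exact zero_mem A
  | add a b ha hb => exact add_mem (ha trivial) (hb trivial)
  | tmul a b =>
    have := mul_mem (hl a) (hr b)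
    simpa using this

/-- The dense affine chart of `E(6)⁴` given by the affine chart of `E(6)`. -/
lemma exists_fourChart : ∃ J : Spec (.of (FourRing k)) ⟶ Z46 k, IsDominant J ∧
    ∀ i, J ≫ coordProj k i =
      Spec.map (CommRingCat.ofHom (fourIncl k i).toRingHom) ≫ affChart k := by
  obtain ⟨J₂, ho, hd, hfst, hsnd⟩ := exists_chart_pullback (E6Str k) (AffRing k) (affChart k)
    (affChart_str k)
  have hstr : J₂ ≫ E6SqStr k =
      Spec.map (CommRingCat.ofHom (algebraMap k (AffRing k ⊗[k] AffRing k))) := by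
    rw [E6SqStr, reassoc_of% hfst, affChart_str, ← Spec.map_comp]
    rfl
  obtain ⟨J, hd', hfst', hsnd'⟩ : ∃ J : Spec (.of (FourRing k)) ⟶ Z46 k, IsDominant J ∧
      J ≫ sqFst k =
        Spec.map (CommRingCat.ofHom Algebra.TensorProduct.includeLeftRingHom) ≫ J₂ ∧
      J ≫ sqSnd k =
        Spec.map (CommRingCat.ofHom (Algebra.TensorProduct.includeRight :
          AffRing k ⊗[k] AffRing k →ₐ[k] FourRing k).toRingHom) ≫ J₂ := by
    obtain ⟨J, -, h⟩ := exists_chart_pullback (E6SqStr k) _ J₂ hstr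
    exact ⟨J, h⟩
  refine ⟨J, hd', ?_⟩
  rw [forall_fin_four]
  refine ⟨?_, ?_, ?_, ?_⟩
  · rw [coordProj_zero, reassoc_of% hfst', hfst, ← Spec.map_comp_assoc]
    rfl
  · rw [coordProj_one, reassoc_of% hfst', hsnd, ← Spec.map_comp_assoc]
    rfl
  · rw [coordProj_two, reassoc_of% hsnd', hfst, ← Spec.map_comp_assoc]
    rfl
  · rw [coordProj_three, reassoc_of% hsnd', hsnd, ← Spec.map_comp_assoc]
    rfl

/-- Evaluation of functions on the fourfold product of the affine curve at four points. -/
noncomputable def evalFour (x y : Fin 4 → S) (h : ∀ i, y i ^ 2 = x i ^ 3 - 1) :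
    FourRing k →ₐ[k] S :=
  Algebra.TensorProduct.productMap
    (Algebra.TensorProduct.productMap (evalAff _ _ (h 0)) (evalAff _ _ (h 1)))
    (Algebra.TensorProduct.productMap (evalAff _ _ (h 2)) (evalAff _ _ (h 3)))

lemma evalFour_fourIncl (x y : Fin 4 → S) (h : ∀ i, y i ^ 2 = x i ^ 3 - 1) (i : Fin 4)
    (b : AffRing k) : evalFour x y h (fourIncl k i b) = evalAff (k := k) _ _ (h i) b := by
  fin_cases i <;> simp [evalFour, fourIncl]

lemma isDominant_specMap_of_injective {A B : Type u} [CommRing A] [CommRing B] (φ : A →+* B)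
    (hφ : Function.Injective φ) : IsDominant (Spec.map (CommRingCat.ofHom φ)) :=
  ⟨(PrimeSpectrum.denseRange_comap_iff_ker_le_nilRadical _).mpr
    (((RingHom.injective_iff_ker_eq_bot φ).mp hφ).trans_le bot_le)⟩

/-- Four points of the curve over a field with algebraically independent `x`-coordinates form a
generic point of `E(6)⁴`. -/
lemma isDominant_fourPoint {Ω : Type u} [Field Ω] [Algebra k Ω] (x y : Fin 4 → Ω)
    (h : ∀ i, y i ^ 2 = x i ^ 3 - 1) (hx : AlgebraicIndependent k x) :
    IsDominant (fourPoint (k := k) x y h) := by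
  obtain ⟨J, hJ, hJi⟩ := exists_fourChart (k := k)
  have hfac : fourPoint x y h =
      Spec.map (CommRingCat.ofHom (evalFour (k := k) x y h).toRingHom) ≫ J := by
    refine hom_ext_coordProj fun i => ?_
    rw [fourPoint_coordProj, Category.assoc, hJi, ← Spec.map_comp_assoc, ← CommRingCat.ofHom_comp,
      affPoint]
    congr 3
    exact RingHom.ext fun b => (evalFour_fourIncl x y h i b).symm
  have hinj : Function.Injective (evalFour (k := k) x y h) := by
    refine injective_of_adjoin_points _ (fun i => fourIncl k i (affCoord k 0))
      (fun i => fourIncl k i (affCoord k 1)) (fun i => ?_) adjoin_fourIncl ?_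
    · rw [← map_pow, affCoord_equation, map_sub, map_pow, map_one]
    · simpa [evalFour_fourIncl, evalAff_affCoord] using hx
  have hdom : IsDominant
      (Spec.map (CommRingCat.ofHom (evalFour (k := k) x y h).toRingHom)) :=
    isDominant_specMap_of_injective (evalFour (k := k) x y h).toRingHom hinj
  rw [hfac]
  infer_instance

end FourPoints

/-! ### The generic point of the quotient -/

section GenericPoint

lemma isPrimitiveRoot_neg_sq {k : Type*} [Field k] (h2 : (2 : k) ≠ 0) {ω : k}
    (hω : IsPrimitiveRoot ω 3) : IsPrimitiveRoot (-ω ^ 2) 6 := by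
  have h3 : ω ^ 3 = 1 := hω.pow_eq_one
  have hne : (-1 : k) ≠ 1 := fun h => h2 (by linear_combination -h)
  have h1 : ω ≠ 1 := hω.ne_one (by norm_num)
  have h4 : ω ^ 2 ≠ 1 := hω.pow_ne_one_of_pos_of_lt (by norm_num) (by norm_num)
  refine IsPrimitiveRoot.mk_of_lt _ (by norm_num) ?_ fun l hl hl' h => ?_
  · linear_combination (ω ^ 9 + ω ^ 6 + ω ^ 3 + 1) * h3
  · interval_cases l
    · refine hne ?_
      linear_combination (ω ^ 4 - ω ^ 2 + 1) * h + (1 + ω ^ 3) * h3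
    · exact h1 (by linear_combination h - ω * h3)
    · exact hne (by linear_combination h + (1 + ω ^ 3) * h3)
    · exact h4 (by linear_combination h - (ω ^ 5 + ω ^ 2) * h3)
    · have h5 : -ω = 1 := by linear_combination h + (ω ^ 7 + ω ^ 4 + ω) * h3
      refine hne ?_
      linear_combination (ω ^ 2 - ω + 1) * h5 + h3

variable {k : Type u} [Field k]

/-- The quotient of `E(6)⁴` by the diagonal automorphism has a generic point over the field of
rational functions in four variables. -/
theorem exists_dominant_spec_ratField (h2 : (2 : k) ≠ 0) {ω : k} (hω : IsPrimitiveRoot ω 3)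
    {Y : Scheme.{u}} (sY : Y ⟶ Spec (.of k)) (π : Z46 k ⟶ Y) (hπ : π ≫ sY = Z46Str k)
    [Surjective π] (hinv : g46 hω ≫ π = π) :
    ∃ q : Spec (.of (RatField k)) ⟶ Y, IsDominant q ∧
      q ≫ sY = Spec.map (CommRingCat.ofHom (algebraMap k (RatField k))) := by
  have h3 := three_ne_zero_of_isPrimitiveRoot hω
  obtain ⟨κ, x, y, hxy, hgen⟩ := exists_twist_points h2 h3
  let F := RatField k
  let R := KummerRing κ
  have hζ : IsPrimitiveRoot (algebraMap k F (-ω ^ 2)) 6 :=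
    (isPrimitiveRoot_neg_sq h2 hω).map_of_injective (algebraMap k F).injective
  have h6 : (6 : F) ≠ 0 := by
    have h6k : (6 : k) ≠ 0 := by
      rw [show (6 : k) = 2 * 3 by norm_num]
      exact mul_ne_zero h2 h3
    have h := (map_ne_zero (algebraMap k F)).mpr h6k
    rwa [map_ofNat] at h
  have := kummerRing_nontrivial κ
  have := finite_zpowers_kummerAut κ hζ.pow_eq_one
  have := isInvariant_kummerAut κ hζ h6
  let σ := kummerAut κ hζ.pow_eq_one
  let θ : R := kummerRoot κ
  have hθ : θ ^ 6 = algebraMap F R κ := kummerRoot_pow κ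
  -- The twist becomes isomorphic to the curve itself after adjoining a sixth root of `κ`.
  have htwist {B : Type u} [CommRing B] [Algebra F B] (t : B) (ht : t ^ 6 = algebraMap F B κ)
      (i : Fin 4) : (t ^ 3 * algebraMap F B (y i)) ^ 2 =
        (t ^ 2 * algebraMap F B (x i)) ^ 3 - 1 := by
    have h := congrArg (algebraMap F B) (hxy i)
    simp only [map_mul, map_pow, map_sub, map_one] at h
    linear_combination (algebraMap F B (y i) ^ 2 - algebraMap F B (x i) ^ 3) * ht + h
  let p : Spec (.of R) ⟶ Z46 k := fourPoint (fun i => θ ^ 2 * algebraMap F R (x i))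
    (fun i => θ ^ 3 * algebraMap F R (y i)) (htwist θ hθ)
  have hω3 : algebraMap k R ω ^ 3 = 1 := by rw [← map_pow, hω.pow_eq_one, map_one]
  have hσθ : σ θ = -algebraMap k R ω ^ 2 * θ := by
    refine (kummerAut_root κ hζ.pow_eq_one).trans ?_
    rw [← IsScalarTower.algebraMap_apply k F R, map_neg, map_pow]
  have hequiv : Spec.map (CommRingCat.ofHom (σ : R →+* R)) ≫ p = p ≫ g46 hω := by
    rw [fourPoint_g46]
    refine fourPoint_naturality ((σ : R →ₐ[F] R).restrictScalars k) _ _ (fun i => ?_) fun i => ?_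
    · change σ (θ ^ 2 * algebraMap F R (x i)) = _
      rw [map_mul, map_pow, hσθ, AlgEquiv.commutes]
      linear_combination (algebraMap k R ω * θ ^ 2 * algebraMap F R (x i)) * hω3
    · change σ (θ ^ 3 * algebraMap F R (y i)) = _
      rw [map_mul, map_pow, hσθ, AlgEquiv.commutes]
      linear_combination
        (-(algebraMap k R ω ^ 3 + 1) * θ ^ 3 * algebraMap F R (y i)) * hω3
  obtain ⟨q, hq⟩ := exists_desc_of_isInvariant σ (p ≫ π) (by
    rw [reassoc_of% hequiv, hinv])
  refine ⟨q, ?_, ?_⟩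
  · let Ω := AlgebraicClosure F
    obtain ⟨t, ht⟩ := IsAlgClosed.exists_pow_nat_eq (algebraMap F Ω κ) (n := 6) (by norm_num)
    let ψ : R →ₐ[F] Ω := kummerLift t ht
    have hψθ : ψ θ = t := kummerLift_root t ht
    have hgenpt : Spec.map (CommRingCat.ofHom (ψ : R →+* Ω)) ≫ p =
        fourPoint (k := k) (fun i => t ^ 2 * algebraMap F Ω (x i))
          (fun i => t ^ 3 * algebraMap F Ω (y i)) (htwist t ht) := by
      refine fourPoint_naturality (ψ.restrictScalars k) _ _ (fun i => ?_) fun i => ?_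
      · change ψ (θ ^ 2 * algebraMap F R (x i)) = _
        rw [map_mul, map_pow, hψθ, AlgHom.commutes]
      · change ψ (θ ^ 3 * algebraMap F R (y i)) = _
        rw [map_mul, map_pow, hψθ, AlgHom.commutes]
    have hdom := isDominant_fourPoint (k := k) _ _ (htwist t ht) (hgen Ω t ht)
    rw [← hgenpt] at hdom
    have hdom' : IsDominant ((Spec.map (CommRingCat.ofHom (ψ : R →+* Ω)) ≫
        Spec.map (CommRingCat.ofHom (algebraMap F R))) ≫ q) := by
      rw [Category.assoc, hq, ← Category.assoc]
      infer_instance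
    exact IsDominant.of_comp _ q (H := hdom')
  · have hstr : Spec.map (CommRingCat.ofHom (algebraMap F R)) ≫ q ≫ sY =
        Spec.map (CommRingCat.ofHom (algebraMap k R)) := by
      rw [reassoc_of% hq, hπ, fourPoint_str]
    obtain ⟨φ, hφ⟩ := Spec.map_surjective (q ≫ sY)
    rw [← hφ, ← Spec.map_comp] at hstr
    have h := Spec.map_injective hstr
    rw [← hφ]
    congr 1
    refine CommRingCat.hom_ext (RingHom.ext fun c => (algebraMap F R).injective ?_)
    refine (DFunLike.congr_fun (congrArg CommRingCat.Hom.hom h) c).trans ?_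
    exact IsScalarTower.algebraMap_apply k F R c

end GenericPoint

/-! ### From generic points to dominant rational maps -/

section Spreading

/-- A generic point of `Y` lifts along a morphism that is an isomorphism over a dense open subset
with dense preimage, and the lift is a generic point. -/
lemma exists_lift_of_isIso_restrict {K : Type u} [Field K] {X Y : Scheme.{u}} (f : X ⟶ Y)
    (V : Y.Opens) (hV : Dense (V : Set Y)) (hV' : Dense ((f ⁻¹ᵁ V : X.Opens) : Set X))
    [IsIso (f ∣_ V)] (q : Spec (.of K) ⟶ Y) [IsDominant q] :
    ∃ g : Spec (.of K) ⟶ X, g ≫ f = q ∧ IsDominant g := by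
  have hsub : Subsingleton (Spec (.of K)) := inferInstanceAs (Subsingleton (PrimeSpectrum K))
  have hne : Nonempty (Spec (.of K)) := inferInstanceAs (Nonempty (PrimeSpectrum K))
  have hrange : Set.range q ⊆ Set.range V.ι := by
    rw [Scheme.Opens.range_ι]
    obtain ⟨_, hs, s, rfl⟩ := q.denseRange.inter_open_nonempty (V : Set Y) V.isOpen
      (hV.nonempty_iff.mpr (hne.map q))
    rintro _ ⟨t, rfl⟩
    rwa [Subsingleton.elim t s]
  let q' := IsOpenImmersion.lift V.ι q hrange
  have hq' : q' ≫ V.ι = q := IsOpenImmersion.lift_fac _ _ _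
  have hd : IsDominant q' := IsDominant.of_comp_of_isOpenImmersion q' V.ι (H := by rwa [hq'])
  have hd' : IsDominant (f ⁻¹ᵁ V).ι := Opens.isDominant_ι hV'
  refine ⟨q' ≫ inv (f ∣_ V) ≫ (f ⁻¹ᵁ V).ι, ?_, inferInstance⟩
  rw [Category.assoc, Category.assoc, ← morphismRestrict_ι, IsIso.inv_hom_id_assoc, hq']

variable {k : Type u} [Field k]

lemma toStalk_genericPoint_injective (R : CommRingCat.{u}) [IsDomain R] :
    Function.Injective (StructureSheaf.toStalk R (genericPoint (Spec R))).hom :=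
  IsFractionRing.injective R (Spec R).functionField

/-- A dominant point over the field of rational functions spreads out to a dominant morphism from
an open subset of the spectrum of a domain containing the polynomial ring. -/
lemma exists_spread_out {A : Type u} [CommRing A] [IsDomain A] [Algebra k A]
    (i : MvPolynomial (Fin 4) k →ₐ[k] A) (hi : Function.Injective i) {X : Scheme.{u}}
    (sX : X ⟶ Spec (.of k)) [LocallyOfFiniteType sX] (g : Spec (.of (RatField k)) ⟶ X)
    [IsDominant g]
    (hg : g ≫ sX = Spec.map (CommRingCat.ofHom (algebraMap k (RatField k)))) :
    ∃ (W : (Spec (.of A)).Opens) (h : W.toScheme ⟶ X), Dense (W : Set (Spec (.of A))) ∧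
      IsDominant h ∧ h ≫ sX = W.ι ≫ Spec.map (CommRingCat.ofHom (algebraMap k A)) := by
  have hA : IsDomain (CommRingCat.of A) := inferInstanceAs (IsDomain A)
  let K := (Spec (.of A)).functionField
  let a : A →+* K := (StructureSheaf.toStalk (CommRingCat.of A) (genericPoint (Spec (.of A)))).hom
  have ha : Function.Injective a :=  toStalk_genericPoint_injective (.of A)
  let j : RatField k →+* K := IsFractionRing.lift
    (show Function.Injective (a.comp (i : MvPolynomial (Fin 4) k →+* A)) from ha.comp hi)
  have hj : j.comp (algebraMap k (RatField k)) = a.comp (algebraMap k A) := by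
    refine RingHom.ext fun c => ?_
    rw [RingHom.comp_apply, IsScalarTower.algebraMap_apply k (MvPolynomial (Fin 4) k) (RatField k)]
    refine (IsFractionRing.lift_algebraMap _ _).trans ?_
    exact congrArg a (i.commutes c)
  have hjd : IsDominant (Spec.map (CommRingCat.ofHom j)) :=
    isDominant_specMap_of_injective j j.injective
  have hcomp : (Spec.map (CommRingCat.ofHom j) ≫ g) ≫ sX =
      (Spec (.of A)).fromSpecStalk (genericPoint (Spec (.of A))) ≫
        Spec.map (CommRingCat.ofHom (algebraMap k A)) := by
    have hstalk : (Spec (.of A)).fromSpecStalk (genericPoint (Spec (.of A))) =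
        Spec.map (CommRingCat.ofHom a) := Spec.fromSpecStalk_eq' _ _
    rw [Category.assoc, hg, hstalk, ← Spec.map_comp, ← Spec.map_comp,
      ← CommRingCat.ofHom_comp, ← CommRingCat.ofHom_comp, hj]
  obtain ⟨W, hW, h, hφ, hh⟩ := spread_out_of_isGermInjective'
    (Spec.map (CommRingCat.ofHom (algebraMap k A))) sX _ hcomp
  have hdom : IsDominant (Spec.map (CommRingCat.ofHom j) ≫ g) := inferInstance
  rw [hφ] at hdom
  exact ⟨W, h, W.isOpen.dense ⟨_, hW⟩, IsDominant.of_comp _ h (H := hdom), hh⟩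

end Spreading

section ProjectiveSpaceChart

open HomogeneousLocalization

variable (k : Type u) [Field k]

attribute [local instance] MvPolynomial.gradedAlgebra

lemma X_mem_homogeneousSubmodule (i : Fin 5) :
    (X i : MvPolynomial (Fin 5) k) ∈ homogeneousSubmodule (Fin 5) k 1 :=
  (mem_homogeneousSubmodule 1 _).mpr (isHomogeneous_X k i)

/-- The coordinate ring of the chart `{x₄ ≠ 0}` of `ℙ⁴`. -/
abbrev ChartRing : Type u := Away (homogeneousSubmodule (Fin 5) k) (X 4)

instance : IsDomain (ChartRing k) := by
  have hloc : IsDomain (Localization.Away (X 4 : MvPolynomial (Fin 5) k)) :=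
    IsLocalization.isDomain_localization
      (powers_le_nonZeroDivisors_of_noZeroDivisors (X_ne_zero _))
  exact (val_injective (𝒜 := homogeneousSubmodule (Fin 5) k)
    (Submonoid.powers (X 4 : MvPolynomial (Fin 5) k))).isDomain
    (algebraMap (ChartRing k) (Localization.Away (X 4 : MvPolynomial (Fin 5) k)))

/-- The affine coordinates `xᵢ / x₄` on the chart `{x₄ ≠ 0}` of `ℙ⁴`. -/
noncomputable def chartCoord : MvPolynomial (Fin 4) k →ₐ[k] ChartRing k :=
  aeval fun i => Away.mk (homogeneousSubmodule (Fin 5) k) (X_mem_homogeneousSubmodule k 4) 1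
    (X i.castSucc) (by rw [one_smul]; exact X_mem_homogeneousSubmodule k i.castSucc)

/-- Setting `x₄ = 1` is a left inverse of the inclusion of the affine coordinates. -/
lemma chartCoord_injective : Function.Injective (chartCoord k) := by
  let e : MvPolynomial (Fin 5) k →ₐ[k] MvPolynomial (Fin 4) k := aeval (Fin.snoc X 1)
  have he : e (X 4) = 1 := by
    rw [aeval_X]
    exact Fin.snoc_last (α := fun _ => MvPolynomial (Fin 4) k) _ _
  let r := awayEval (homogeneousSubmodule (Fin 5) k) (X_mem_homogeneousSubmodule k 4) e he
  have hr : r.comp (chartCoord k) = AlgHom.id k _ := by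
    refine MvPolynomial.algHom_ext fun i => ?_
    rw [AlgHom.comp_apply, chartCoord, aeval_X, AlgHom.id_apply]
    refine (awayEval_mk _ _ _ _ _ _ _).trans ?_
    rw [aeval_X]
    exact Fin.snoc_castSucc (α := fun _ => MvPolynomial (Fin 4) k) _ _ _
  exact Function.LeftInverse.injective (g := r) fun p => DFunLike.congr_fun hr p

/-- The chart `{x₄ ≠ 0}` of `ℙ⁴`. -/
noncomputable def projChart : Spec (.of (ChartRing k)) ⟶ projectiveSpace k 4 :=
  Proj.awayι (homogeneousSubmodule (Fin 5) k) (X 4) (X_mem_homogeneousSubmodule k 4) one_pos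

instance : IsOpenImmersion (projChart k) :=
  inferInstanceAs (IsOpenImmersion (Proj.awayι (homogeneousSubmodule (Fin 5) k) (X 4)
    (X_mem_homogeneousSubmodule k 4) one_pos))

instance : IsDominant (projChart k) :=
  isDominant_awayι (homogeneousSubmodule (Fin 5) k) (X_mem_homogeneousSubmodule k 4) one_pos
    (mem_nonZeroDivisors_of_ne_zero (X_ne_zero _))

lemma projChart_str : projChart k ≫ projectiveSpaceStr k 4 =
    Spec.map (CommRingCat.ofHom (algebraMap k (ChartRing k))) :=
  awayι_projStr (homogeneousSubmodule (Fin 5) k) (X 4) (X_mem_homogeneousSubmodule k 4) one_pos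

variable {k}

/-- A scheme locally of finite type over `k` with a generic point over the field of rational
functions in four variables is `4`-unirational. -/
theorem isUnirational_of_isDominant {X : Scheme.{u}} (sX : X ⟶ Spec (.of k))
    [LocallyOfFiniteType sX] (g : Spec (.of (RatField k)) ⟶ X) [IsDominant g]
    (hg : g ≫ sX = Spec.map (CommRingCat.ofHom (algebraMap k (RatField k)))) :
    IsUnirational 4 sX := by
  obtain ⟨W, h, hW, hdom, hh⟩ := exists_spread_out (chartCoord k) (chartCoord_injective k) sX g hg
  have hdense : Dense ((projChart k ''ᵁ W : (projectiveSpace k 4).Opens) :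
      Set (projectiveSpace k 4)) :=
    (projChart k).denseRange.dense_image (projChart k).continuous hW
  let φ : (projectiveSpace k 4).PartialMap X :=
    { domain := projChart k ''ᵁ W
      dense_domain := hdense
      hom := ((projChart k).isoImage W).inv ≫ h }
  refine ⟨φ.toRationalMap, ?_, ?_⟩
  · rw [Scheme.PartialMap.isDominant_toRationalMap_iff]
    exact inferInstanceAs (IsDominant (((projChart k).isoImage W).inv ≫ h))
  · rw [← Scheme.RationalMap.compHom_toRationalMap, Scheme.PartialMap.toRationalMap_eq_iff]
    refine ⟨projChart k ''ᵁ W, hdense, le_rfl, le_top, ?_⟩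
    have h1 : (((projChart k).isoImage W).inv ≫ h) ≫ sX =
        (projChart k ''ᵁ W).ι ≫ projectiveSpaceStr k 4 := by
      rw [Category.assoc, hh, ← projChart_str, ← Scheme.Hom.isoImage_inv_ι_assoc]
    change Scheme.homOfLE _ _ ≫ (((projChart k).isoImage W).inv ≫ h) ≫ sX =
      Scheme.homOfLE _ _ ≫ (Scheme.topIso _).hom ≫ projectiveSpaceStr k 4
    rw [h1, Scheme.topIso_hom, Scheme.homOfLE_ι_assoc, Scheme.homOfLE_ι_assoc]

end ProjectiveSpaceChart

end Ueno

theorem mainTheorem1 {k : Type u} [Field k] (h2 : (2 : k) ≠ 0) {ω : k} (hω : IsPrimitiveRoot ω 3)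
    {Y : Scheme.{u}} (sY : Y ⟶ Spec (.of k)) (π : Ueno.Z46 k ⟶ Y) (hπ : π ≫ sY = Ueno.Z46Str k)
    (hY : Ueno.IsCyclicQuotient (Ueno.g46 hω) π)
    {X : Scheme.{u}} (f : X ⟶ Y) (hX : Ueno.IsResolution sY f) :
    Ueno.IsUnirational 4 (f ≫ sY) := by
  have hsurj : Surjective π := ⟨hY.isQuotientMap.surjective⟩
  obtain ⟨q, hq, hqs⟩ := Ueno.exists_dominant_spec_ratField h2 hω sY π hπ hY.invariant
  obtain ⟨V, hV, hV', hiso⟩ := hX.birational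
  obtain ⟨g, hgf, hg⟩ := Ueno.exists_lift_of_isIso_restrict f V hV hV' q
  have hsmooth := hX.smooth
  exact Ueno.isUnirational_of_isDominant (f ≫ sY) g (by rw [reassoc_of% hgf, hqs])
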